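/- Let $X,Y$ be Banach spaces over $\mathbb K$, where $\mathbb K=\mathbb R$ or $\mathbb K=\mathbb C$, and let $T:X\to Y$ be a bounded linear operator. Terminology. Let $\lambda\ge 1$. A finite sequence $(b_i)_{i=1}^n$ in $X$ is called $\lambda$-basic if $\|\sum_{i=1}^k c_ib_i\|\le\lambda\|\sum_{i=1}^n c_ib_i\|$ for all $1\le k\le n$ and all scalars $c_1,\dots,c_n$. It is called $\lambda$-wide-$(s)$ if it is $2\lambda$-basic, $\|b_i\|\le\lambda$ for all $i$, and $|\sum_{i=k}^n c_i|\le\lambda\|\sum_{i=1}^n c_ib_i\|$ for all $1\le k\le n$ and all scalars $c_1,\dots,c_n$. A finite sequence $(e_i)_{i=1}^n$ in $X$ is called $\lambda$-wide-$(c)$ if it is $\lambda$-basic, $\|e_i\|\ge 1/\lambda$ for all $i$, and $\|\sum_{i=1}^k e_i\|\le\lambda$ for all $1\le k\le n$. A bounded linear operator $S:E\to F$ between Banach spaces is called Tauberian if $S^{**}(E^{**}\setminus E)\subset F^{**}\setminus F$. Let $\mathcal U$ be any non-principal ultrafilter on $\mathbb N$. The ultrapower $X_{\mathcal U}$ is the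 quotient of $\ell^\infty(X)$ by the closed subspace of sequences $(x_j)$ with $\lim_{j\in\mathcal U}\|x_j\|=0$, and $T_{\mathcal U}:X_{\mathcal U}\to Y_{\mathcal U}$ is the operator $[(x_j)]\mapsto[(Tx_j)]$. The operator $T$ is called super-Tauberian if $T_{\mathcal U}$ is Tauberian. Claim. For every non-principal ultrafilter $\mathcal U$ on $\mathbb N$ the following are equivalent (so that, in particular, being super-Tauberian does not depend on $\mathcal U$): 1. $T$ is non-super-Tauberian. 2. There is a $\lambda\ge1$ such that for all $n$ and all $\varepsilon>0$ there exist $b_1,\dots,b_n$ in $X$ with $(b_i)_{i=1}^n$ $\lambda$-wide-$(s)$ and $\operatorname{diam}\{Tb_i:1\le i\le n\}<\varepsilon$. 3. For all $\varepsilon>0$ and all $n$ there exist $b_1,\dots,b_n$ in $X$ with $(b_i)_{i=1}^n$ $(1+\varepsilon)$-wide-$(s)$ and $\operatorname{diam}\{Tb_i:1\le i\le n\}<\varepsilon$. 4. There is a $\lambda\ge1$ such that for all $n$ and all $\varepsilon>0$ there exist $e_1,\dots,e_n$ in $X$ with $(e_i)_{i=1}^n$ $\lambda$-wide-$(c)$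 and $\sum_{i=1}^n\|Te_i\|<\varepsilon$. 5. For all $\varepsilon>0$ and all $n$ there exist $b_1,\dots,b_n$ in $X$ with $\|b_i\|=1$ for all $i$, $(b_i)_{i=1}^n$ $(1+\varepsilon)$-wide-$(s)$, and $\|Tb_i\|<\varepsilon$ for all $1\le i\le n$. -/

import Mathlib

open Filter Topology
open scoped ENNReal

section WideSequences

/-- A finite sequence is `K`-basic if the norm of every initial partial sum of a linear
combination is at most `K` times the norm of the whole combination. -/
def IsFiniteBasic (𝕜 : Type*) {X : Type*} [RCLike 𝕜] [NormedAddCommGroup X] [NormedSpace 𝕜 X]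
    (K : ℝ) {n : ℕ} (b : Fin n → X) : Prop :=
  ∀ (k : Fin n) (c : Fin n → 𝕜),
    ‖∑ j ∈ Finset.Iic k, c j • b j‖ ≤ K * ‖∑ j, c j • b j‖

/-- A finite sequence is `L`-wide-(s). -/
structure IsWideS (𝕜 : Type*) {X : Type*} [RCLike 𝕜] [NormedAddCommGroup X] [NormedSpace 𝕜 X]
    (L : ℝ) {n : ℕ} (b : Fin n → X) : Prop where
  basic : IsFiniteBasic 𝕜 (2 * L) b
  norm_le : ∀ j, ‖b j‖ ≤ L
  tail_le : ∀ (k : Fin n) (c : Fin n → 𝕜),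
    ‖∑ j ∈ Finset.Ici k, c j‖ ≤ L * ‖∑ j, c j • b j‖

/-- A finite sequence is `L`-wide-(c). -/
structure IsWideC (𝕜 : Type*) {X : Type*} [RCLike 𝕜] [NormedAddCommGroup X] [NormedSpace 𝕜 X]
    (L : ℝ) {n : ℕ} (e : Fin n → X) : Prop where
  basic : IsFiniteBasic 𝕜 L e
  le_norm : ∀ j, 1 / L ≤ ‖e j‖
  norm_sum_le : ∀ k : Fin n, ‖∑ j ∈ Finset.Iic k, e j‖ ≤ L

end WideSequences

noncomputable section Tauberian

variable {𝕜 : Type*} [RCLike 𝕜]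
  {X Y : Type*} [NormedAddCommGroup X] [NormedSpace 𝕜 X]
  [NormedAddCommGroup Y] [NormedSpace 𝕜 Y]

/-- The Banach space adjoint `T* : Y* → X*`, `f ↦ f ∘ T`. -/
def dualOperator (T : X →L[𝕜] Y) : StrongDual 𝕜 Y →L[𝕜] StrongDual 𝕜 X :=
  ContinuousLinearMap.precomp 𝕜 T

/-- `T` is Tauberian if `T**` maps `X** \ X` into `Y** \ Y`. -/
def IsTauberian (T : X →L[𝕜] Y) : Prop :=
  ∀ G : StrongDual 𝕜 (StrongDual 𝕜 X),
    G ∉ Set.range (NormedSpace.inclusionInDoubleDual 𝕜 X) →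
      dualOperator (dualOperator T) G ∉ Set.range (NormedSpace.inclusionInDoubleDual 𝕜 Y)

end Tauberian

noncomputable section Ultrapowers

/-- The bounded sequences in `X` whose norms tend to `0` along the ultrafilter `U`. -/
def ultraNull (𝕜 X : Type*) [RCLike 𝕜] [NormedAddCommGroup X] [NormedSpace 𝕜 X]
    (U : Ultrafilter ℕ) : Submodule 𝕜 (lp (fun _ : ℕ => X) ∞) where
  carrier := {x | Tendsto (fun n => ‖x n‖) (U : Filter ℕ) (𝓝 0)}
  zero_mem' := by simp
  add_mem' := by
    intro x y hx hy
    have hx' := tendsto_zero_iff_norm_tendsto_zero.2 hx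
    have hy' := tendsto_zero_iff_norm_tendsto_zero.2 hy
    exact tendsto_zero_iff_norm_tendsto_zero.1 (by simpa using! hx'.add hy')
  smul_mem' := by
    intro c x hx
    have hx' := tendsto_zero_iff_norm_tendsto_zero.2 hx
    exact tendsto_zero_iff_norm_tendsto_zero.1 (by simpa using! hx'.const_smul c)

instance ultraNull_isClosed (𝕜 X : Type*) [RCLike 𝕜] [NormedAddCommGroup X] [NormedSpace 𝕜 X]
    (U : Ultrafilter ℕ) : IsClosed (ultraNull 𝕜 X U : Set (lp (fun _ : ℕ => X) ∞)) := by
  refine isClosed_of_closure_subset fun x hx => ?_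
  change Tendsto (fun n => ‖x n‖) (U : Filter ℕ) (𝓝 0)
  rw [Metric.tendsto_nhds]
  intro ε hε
  obtain ⟨y, hy, hxy⟩ := Metric.mem_closure_iff.1 hx (ε / 2) (half_pos hε)
  have hy' : Tendsto (fun n => ‖y n‖) (U : Filter ℕ) (𝓝 0) := hy
  filter_upwards [Metric.tendsto_nhds.1 hy' (ε / 2) (half_pos hε)] with n hn
  have h1 : ‖x n - y n‖ ≤ ‖x - y‖ := lp.norm_apply_le_norm (by simp) (x - y) n
  rw [dist_eq_norm] at hxy
  simp only [dist_zero_right, norm_norm] at hn ⊢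
  have h2 : ‖x n‖ ≤ ‖x n - y n‖ + ‖y n‖ := by
    simpa using norm_add_le (x n - y n) (y n)
  linarith

/-- The ultrapower `X_U`, that is `ℓ^∞(X)` modulo the sequences that are null along `U`,
with the quotient norm. -/
abbrev Ultrapower (𝕜 X : Type*) [RCLike 𝕜] [NormedAddCommGroup X] [NormedSpace 𝕜 X]
    (U : Ultrafilter ℕ) : Type _ :=
  lp (fun _ : ℕ => X) ∞ ⧸ ultraNull 𝕜 X U

variable {𝕜 : Type*} [RCLike 𝕜]
  {X Y : Type*} [NormedAddCommGroup X] [NormedSpace 𝕜 X]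
  [NormedAddCommGroup Y] [NormedSpace 𝕜 Y]

/-- The operator `ℓ^∞(X) → ℓ^∞(Y)`, `(x_n) ↦ (T x_n)`. -/
def seqOperator (T : X →L[𝕜] Y) :
    lp (fun _ : ℕ => X) ∞ →L[𝕜] lp (fun _ : ℕ => Y) ∞ :=
  lp.mapCLM ∞ (fun _ => T) (norm_nonneg T) (fun _ => le_rfl)

theorem seqOperator_apply (T : X →L[𝕜] Y) (x : lp (fun _ : ℕ => X) ∞) (n : ℕ) :
    seqOperator T x n = T (x n) := rfl

theorem ultraNull_le_ker (U : Ultrafilter ℕ) (T : X →L[𝕜] Y) :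
    ultraNull 𝕜 X U ≤ ((ultraNull 𝕜 Y U).mkQL.comp (seqOperator T)).ker := by
  intro x hx
  have hx' : Tendsto (fun n => x n) (U : Filter ℕ) (𝓝 0) :=
    tendsto_zero_iff_norm_tendsto_zero.2 hx
  have h1 : Tendsto (fun n => T (x n)) (U : Filter ℕ) (𝓝 0) := by
    simpa using! (T.continuous.tendsto 0).comp hx'
  have h2 : seqOperator T x ∈ ultraNull 𝕜 Y U := tendsto_zero_iff_norm_tendsto_zero.1 h1
  simpa using h2

/-- The ultrapower operator `T_U : X_U → Y_U`, `[(x_n)] ↦ [(T x_n)]`. -/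
def ultraOperator (U : Ultrafilter ℕ) (T : X →L[𝕜] Y) :
    Ultrapower 𝕜 X U →L[𝕜] Ultrapower 𝕜 Y U :=
  (ultraNull 𝕜 X U).liftQL ((ultraNull 𝕜 Y U).mkQL.comp (seqOperator T)) (ultraNull_le_ker U T)

/-- `T` is super-Tauberian (with respect to the ultrafilter `U`) if `T_U` is Tauberian. -/
def IsSuperTauberian (U : Ultrafilter ℕ) (T : X →L[𝕜] Y) : Prop :=
  IsTauberian (ultraOperator U T)

end Ultrapowers

/-! ### Local reflexivity tools: Helly's theorem and approximation in the bidual. -/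

section DualSpaces

variable {𝕜 : Type*} [RCLike 𝕜] {E F : Type*} [NormedAddCommGroup E] [NormedSpace 𝕜 E]
  [NormedAddCommGroup F] [NormedSpace 𝕜 F]

/-! A wide-(s) sequence is a finite trace of non-reflexivity. If `G` lies in the bidual but not in
the space, James' construction picks vectors that imitate `G` on more and more functionals.
Functionals that vanish on the earlier vectors and take the value 1 on the later ones then bound the
tail sums (`exists_seq_tail_functionals`). Conversely, a bounded infinite sequence with bounded tail
sums has a weak* limit outside the space (`exists_tendsto_notMem_range_inclusion`).

If `T_U` is not Tauberian, some such `G` is sent into the target, so the vectors can be chosen with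
nearly equal images. Finitely many vectors of an ultrapower have coordinates spanning almost
isometric copies (`IsWideS.eventually_of_ultrapower`), which brings the sequence down to `X`. In the
other direction, finite sequences of growing length in `X` assemble into an infinite sequence in the
ultrapower on which `T_U` is constant (`exists_ultrapower_seq`). Its weak* limit shows that `T_U` is
not Tauberian, and its differences show that the kernel of `T_U` is not reflexive. James'
construction inside that kernel gives the normalized sequences with constant close to 1, whatever
the initial constant was.

Passing between the two kinds of wide sequence is Abel summation: differences of a wide-(s) sequence
are wide-(c), partial sums of a wide-(c) sequence are wide-(s). -/

/-- **Helly's theorem** on the approximate solvability of finitely many linear equations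
with a norm bound. -/
theorem exists_norm_lt_forall_apply_eq {ι : Type*} [Fintype ι] (φ : ι → StrongDual 𝕜 E)
    (a : ι → 𝕜) {M r : ℝ} (hM : 0 ≤ M) (hr : M < r)
    (h : ∀ c : ι → 𝕜, ‖∑ i, c i * a i‖ ≤ M * ‖∑ i, c i • φ i‖) :
    ∃ z : E, ‖z‖ < r ∧ ∀ i, φ i z = a i := by
  classical
  -- If the system had no solution, a linear functional separating `a` from the range would be a
  -- relation among the `φ i` that `a` violates, against `h`.
  obtain ⟨z₀, hz₀⟩ : ∃ z₀ : E, ∀ i, φ i z₀ = a i := by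
    let P : E →ₗ[𝕜] (ι → 𝕜) := LinearMap.pi fun i => (φ i : E →ₗ[𝕜] 𝕜)
    by_contra! hne
    have ha : a ∉ LinearMap.range P := by
      rintro ⟨z, hz⟩
      obtain ⟨i, hi⟩ := hne z
      exact hi (congrFun hz i)
    obtain ⟨f, hfa, hf⟩ := Submodule.exists_le_ker_of_notMem ha
    have hsum : ∀ v : ι → 𝕜, f v = ∑ i, f (Pi.single i 1) * v i := by
      intro v
      conv_lhs => rw [pi_eq_sum_univ' v, map_sum]
      refine Finset.sum_congr rfl fun i _ => ?_
      rw [map_smul, smul_eq_mul, mul_comm]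
    have hz : ∑ i, f (Pi.single i 1) • φ i = 0 := by
      ext z
      have : f (P z) = 0 := hf ⟨z, rfl⟩
      rw [hsum] at this
      simpa [P] using this
    have := h fun i => f (Pi.single i 1)
    rw [hz, ← hsum] at this
    simp at this
    exact hfa this
  -- The solutions form the coset `z₀ + N`. A functional norming it in the quotient pulls back to a
  -- combination of the `φ i`, so `h` bounds the quotient norm by `M`.
  let N : Submodule 𝕜 E := ⨅ i, (φ i : E →ₗ[𝕜] 𝕜).ker
  have hN : IsClosed (N : Set E) := by
    simp only [N, Submodule.coe_iInf]
    exact isClosed_iInter fun i => (φ i).isClosed_ker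
  obtain ⟨ψ, hψ, hψz⟩ := exists_dual_vector'' 𝕜 (N.mkQL z₀)
  have hle : ⨅ i, (φ i : E →ₗ[𝕜] 𝕜).ker ≤ ((ψ.comp N.mkQL : StrongDual 𝕜 E) : E →ₗ[𝕜] 𝕜).ker := by
    intro z hz
    have hz0 : N.mkQL z = 0 := (Submodule.Quotient.mk_eq_zero N).2 hz
    change ψ (N.mkQL z) = 0
    rw [hz0, map_zero]
  obtain ⟨c, hc⟩ := (Submodule.mem_span_range_iff_exists_fun 𝕜).1 (mem_span_of_iInf_ker_le_ker hle)
  have hc' : ∑ i, c i • φ i = ψ.comp N.mkQL := by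
    ext z
    simpa using congrArg (fun g : E →ₗ[𝕜] 𝕜 => g z) hc
  have hnorm : ‖∑ i, c i • φ i‖ ≤ 1 := by
    rw [hc']
    refine ContinuousLinearMap.opNorm_le_bound _ zero_le_one fun z => ?_
    calc ‖ψ (N.mkQL z)‖ ≤ ‖ψ‖ * ‖N.mkQL z‖ := ψ.le_opNorm _
      _ ≤ 1 * ‖z‖ := by
        gcongr
        exact Submodule.Quotient.norm_mk_le N z
  have hval : ‖N.mkQL z₀‖ ≤ M := by
    have h1 : (∑ i, c i * a i) = ((‖N.mkQL z₀‖ : ℝ) : 𝕜) := by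
      rw [← hψz]
      have := congrArg (fun g : StrongDual 𝕜 E => g z₀) hc'
      simpa [hz₀] using this
    have h2 := h c
    rw [h1, RCLike.norm_ofReal, abs_of_nonneg (norm_nonneg _)] at h2
    nlinarith
  obtain ⟨z, hz, hzr⟩ := Submodule.Quotient.norm_mk_lt (N.mkQL z₀) (sub_pos.2 hr)
  refine ⟨z, by linarith, fun i => ?_⟩
  have : z - z₀ ∈ N := (Submodule.Quotient.eq N).1 hz
  have := (Submodule.mem_iInf _).1 this i
  rw [← hz₀ i]
  exact sub_eq_zero.1 (by simpa using this)

/-- Elements of the open unit ball of the bidual are approximated by elements of the open unit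
ball of the space, exactly on finitely many functionals. -/
theorem exists_norm_lt_one_forall_mem_finset {G : StrongDual 𝕜 (StrongDual 𝕜 E)} (hG : ‖G‖ < 1)
    (Φ : Finset (StrongDual 𝕜 E)) : ∃ z : E, ‖z‖ < 1 ∧ ∀ φ ∈ Φ, φ z = G φ := by
  obtain ⟨z, hz, h⟩ := exists_norm_lt_forall_apply_eq (fun φ : Φ => (φ : StrongDual 𝕜 E))
    (fun φ => G φ) (norm_nonneg G) hG fun c => by
      have : ∑ i : Φ, c i * G i = G (∑ i : Φ, c i • (i : StrongDual 𝕜 E)) := by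
        simp [map_sum]
      rw [this]
      exact G.le_opNorm _
  exact ⟨z, hz, fun φ hφ => h ⟨φ, hφ⟩⟩

/-- A point of the bidual in the open unit ball which the bidual operator maps to the point `y`
is approximated by points of the open unit ball mapped close to `y`. -/
theorem exists_norm_lt_one_forall_mem_finset_norm_sub_lt {G : StrongDual 𝕜 (StrongDual 𝕜 E)}
    (hG : ‖G‖ < 1) {S : E →L[𝕜] F} {y : F}
    (hy : dualOperator (dualOperator S) G = NormedSpace.inclusionInDoubleDual 𝕜 F y)
    {ε : ℝ} (hε : 0 < ε) (Φ : Finset (StrongDual 𝕜 E)) :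
    ∃ z : E, (‖z‖ ≤ 1 ∧ ‖S z - y‖ < ε) ∧ ∀ φ ∈ Φ, φ z = G φ := by
  classical
  let _ : NormedSpace ℝ E := NormedSpace.restrictScalars ℝ 𝕜 E
  let _ : NormedSpace ℝ F := NormedSpace.restrictScalars ℝ 𝕜 F
  let C : Set E := {z | ‖z‖ ≤ 1 ∧ ∀ φ ∈ Φ, φ z = G φ}
  have hreal : ∀ (a : ℝ) (z : E), a • z = (a : 𝕜) • z := fun a z => (RCLike.real_smul_eq_coe_smul a z)
  have hrealF : ∀ (a : ℝ) (z : F), a • z = (a : 𝕜) • z := fun a z => (RCLike.real_smul_eq_coe_smul a z)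
  have hC : Convex ℝ C := by
    intro z hz w hw a b ha hb hab
    refine ⟨?_, fun φ hφ => ?_⟩
    · have := (convex_closedBall (0 : E) 1) (x := z) (by simpa using hz.1) (y := w)
        (by simpa using hw.1) ha hb hab
      simpa using this
    · rw [hreal, hreal, map_add, map_smul, map_smul, hz.2 φ hφ, hw.2 φ hφ, ← add_smul,
        ← RCLike.ofReal_add, hab]
      simp
  have hSC : Convex ℝ (S '' C) := by
    rintro _ ⟨z, hz, rfl⟩ _ ⟨w, hw, rfl⟩ a b ha hb hab
    refine ⟨a • z + b • w, hC hz hw ha hb hab, ?_⟩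
    rw [map_add, hreal, hreal, map_smul, map_smul, hrealF, hrealF]
  -- Otherwise some `g` strictly separates `y` from the image. Adding `g ∘ S` to `Φ` yields a point
  -- of `C` on which `g ∘ S` equals `g y`.
  have hmem : y ∈ closure (S '' C) := by
    by_contra hn
    obtain ⟨g, u, hgu, huy⟩ := RCLike.geometric_hahn_banach_closed_point (𝕜 := 𝕜) hSC.closure
      isClosed_closure hn
    obtain ⟨z, hz, hzΦ⟩ := exists_norm_lt_one_forall_mem_finset hG (insert (g.comp S) Φ)
    have hzC : z ∈ C := ⟨hz.le, fun φ hφ => hzΦ φ (Finset.mem_insert_of_mem hφ)⟩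
    have h1 := hgu (S z) (subset_closure ⟨z, hzC, rfl⟩)
    have h2 : g (S z) = G (g.comp S) := hzΦ _ (Finset.mem_insert_self _ _)
    have h3 : G (g.comp S) = g y := congrArg (fun H => H g) hy
    rw [h2, h3] at h1
    exact lt_asymm h1 huy
  obtain ⟨_, ⟨z, hz, rfl⟩, hd⟩ := Metric.mem_closure_iff.1 hmem ε hε
  refine ⟨z, ⟨hz.1, ?_⟩, hz.2⟩
  rwa [dist_comm, dist_eq_norm] at hd

/-- A non-reflexive point of the bidual in the open unit ball is approximated by points of the
unit sphere, exactly on finitely many functionals. -/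
theorem exists_norm_eq_one_forall_mem_finset {G : StrongDual 𝕜 (StrongDual 𝕜 E)} (hG : ‖G‖ < 1)
    (hGE : G ∉ Set.range (NormedSpace.inclusionInDoubleDual 𝕜 E))
    (Φ : Finset (StrongDual 𝕜 E)) : ∃ z : E, ‖z‖ = 1 ∧ ∀ φ ∈ Φ, φ z = G φ := by
  classical
  obtain ⟨z, hz, hzΦ⟩ := exists_norm_lt_one_forall_mem_finset hG Φ
  obtain ⟨g, hg⟩ : ∃ g : StrongDual 𝕜 E, g z ≠ G g := by
    by_contra! h
    exact hGE ⟨z, by ext g; exact h g⟩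
  obtain ⟨w, -, hwΦ⟩ := exists_norm_lt_one_forall_mem_finset hG (insert g Φ)
  have hv : w - z ≠ 0 := by
    intro h
    rw [sub_eq_zero.1 h] at hwΦ
    exact hg (hwΦ g (Finset.mem_insert_self _ _))
  have hvpos : 0 < ‖w - z‖ := norm_pos_iff.2 hv
  -- Every point of the line through the two solutions `z` and `w` is a solution; the norm along it
  -- is continuous, starts below 1 and exceeds 1 far out.
  let p : ℝ → ℝ := fun t => ‖z + (t : 𝕜) • (w - z)‖
  have hp : Continuous p := by
    have : Continuous fun t : ℝ => (t : 𝕜) := RCLike.continuous_ofReal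
    fun_prop
  have hp0 : p 0 ≤ 1 := by simpa [p] using hz.le
  have hp1 : 1 ≤ p (2 / ‖w - z‖) := by
    have h1 : ‖((2 / ‖w - z‖ : ℝ) : 𝕜) • (w - z)‖ = 2 := by
      rw [norm_smul, RCLike.norm_ofReal, abs_of_pos (by positivity)]
      field_simp
    have h2 := norm_sub_le (z + ((2 / ‖w - z‖ : ℝ) : 𝕜) • (w - z)) z
    rw [add_sub_cancel_left, h1] at h2
    change 1 ≤ ‖z + ((2 / ‖w - z‖ : ℝ) : 𝕜) • (w - z)‖
    linarith
  obtain ⟨t, -, ht⟩ := intermediate_value_Icc (by positivity : (0 : ℝ) ≤ 2 / ‖w - z‖)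
    hp.continuousOn ⟨hp0, hp1⟩
  refine ⟨_, ht, fun φ hφ => ?_⟩
  simp [hzΦ φ hφ, hwΦ φ (Finset.mem_insert_of_mem hφ)]

/-- If a point `G` of the bidual has distance at least `1 / M` from the space, then finitely many
vectors are annihilated by a functional of norm less than `r > M` on which `G` takes the value
`1`. -/
theorem exists_norm_lt_forall_mem_finset_apply_eq_zero {G : StrongDual 𝕜 (StrongDual 𝕜 E)}
    {M r : ℝ} (hM : 0 ≤ M) (hr : M < r)
    (hG : ∀ x : E, 1 ≤ M * ‖G - NormedSpace.inclusionInDoubleDual 𝕜 E x‖) (s : Finset E) :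
    ∃ f : StrongDual 𝕜 E, ‖f‖ < r ∧ G f = 1 ∧ ∀ v ∈ s, f v = 0 := by
  -- Helly's theorem on the dual space, the prescribed values being 1 for `G` (index `none`) and 0
  -- for the evaluations at the vectors of `s`. Its norm hypothesis is the distance bound after
  -- division by the coefficient of `G`.
  obtain ⟨f, hf, h⟩ := exists_norm_lt_forall_apply_eq (E := StrongDual 𝕜 E)
    (fun i : Option s => i.elim G fun v => NormedSpace.inclusionInDoubleDual 𝕜 E v)
    (fun i => i.elim 1 fun _ => 0) hM hr fun c => by
      simp only [Fintype.sum_option, Option.elim_none, Option.elim_some, mul_one, mul_zero,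
        Finset.sum_const_zero, add_zero]
      by_cases h0 : c none = 0
      · rw [h0]; simp; positivity
      · have h1 := hG (-∑ v : s, (c none)⁻¹ • c (some v) • (v : E))
        have h2 : c none • G + ∑ v : s, c (some v) • NormedSpace.inclusionInDoubleDual 𝕜 E v
            = c none • (G - NormedSpace.inclusionInDoubleDual 𝕜 E
              (-∑ v : s, (c none)⁻¹ • c (some v) • (v : E))) := by
          simp only [map_neg, map_sum, map_smul, sub_neg_eq_add, smul_add, Finset.smul_sum,
            smul_inv_smul₀ h0]
        rw [h2, norm_smul]
        calc ‖c none‖ = ‖c none‖ * 1 := (mul_one _).symm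
          _ ≤ ‖c none‖ * (M * _) := by gcongr
          _ = _ := by ring
  exact ⟨f, hf, h none, fun v hv => h (some ⟨v, hv⟩)⟩

/-- The span of a finite set is normed, up to a constant `r > 1`, by finitely many functionals of
norm at most one. -/
theorem exists_finset_norm_le_mul_norm_apply (s : Finset E) {r : ℝ} (hr : 1 < r) :
    ∃ Γ : Finset (StrongDual 𝕜 E), ∀ v ∈ Submodule.span 𝕜 (s : Set E),
      ∃ g ∈ Γ, ‖g‖ ≤ 1 ∧ ‖v‖ ≤ r * ‖g v‖ := by
  classical
  let V := Submodule.span 𝕜 (s : Set E)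
  have : FiniteDimensional 𝕜 V := FiniteDimensional.span_finset 𝕜 s
  have : ProperSpace V := FiniteDimensional.proper 𝕜 V
  -- A functional norming a net point within `η / 2` of a unit vector `w` takes a value of modulus
  -- at least `1 - η` on `w`: one half is lost in the norm of the net point, the other in moving to
  -- `w`.
  obtain ⟨η, hη, hη1⟩ : ∃ η : ℝ, 0 < η ∧ 1 ≤ r * (1 - η) :=
    ⟨1 - 1 / r, by rw [sub_pos, div_lt_one (by linarith)]; exact hr, by
      have : r ≠ 0 := by positivity
      field_simp; linarith⟩
  obtain ⟨t, -, ht, hcov⟩ := Metric.finite_approx_of_totallyBounded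
    (isCompact_sphere (0 : V) 1).totallyBounded (η / 2) (half_pos hη)
  choose g hg hgv using fun v : V => exists_dual_vector'' 𝕜 (v : E)
  refine ⟨insert 0 (ht.toFinset.image g), fun v hv => ?_⟩
  by_cases hv0 : v = 0
  · exact ⟨0, by simp, by simp, by simp [hv0]⟩
  have hvpos : 0 < ‖v‖ := norm_pos_iff.2 hv0
  let w : V := ((‖v‖⁻¹ : ℝ) : 𝕜) • ⟨v, hv⟩
  have hw : ‖w‖ = 1 := by
    simp only [w, norm_smul, RCLike.norm_ofReal, abs_inv, abs_norm, Submodule.coe_norm]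
    field_simp
  obtain ⟨u, hu, hwu⟩ := Set.mem_iUnion₂.1 (hcov (by simpa using hw : w ∈ Metric.sphere (0 : V) 1))
  have hwu' : ‖(w : E) - u‖ < η / 2 := by
    rw [Metric.mem_ball, dist_eq_norm] at hwu
    simpa using hwu
  refine ⟨g u, by simp only [Finset.mem_insert, Finset.mem_image]; exact Or.inr ⟨u, by simpa using hu, rfl⟩,
    hg u, ?_⟩
  have hu1 : 1 - η / 2 ≤ ‖(u : E)‖ := by
    have h1 : ‖(w : E)‖ = 1 := hw
    have := norm_sub_norm_le (w : E) u
    linarith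
  have h2 : ‖g u ((w : E) - u)‖ ≤ η / 2 := by
    have := (g u).le_opNorm ((w : E) - u)
    nlinarith [hg u, norm_nonneg ((w : E) - u), norm_nonneg (g u)]
  have h3 : ‖g u (u : E)‖ = ‖(u : E)‖ := by
    rw [hgv, RCLike.norm_ofReal, abs_of_nonneg (norm_nonneg _)]
  have h4 : 1 - η ≤ ‖g u (w : E)‖ := by
    have := norm_sub_norm_le (g u (u : E)) (g u (w : E))
    rw [← norm_neg, ← map_neg, neg_sub] at h2
    rw [← map_sub, h3] at this
    linarith
  have h5 : ‖g u (w : E)‖ = ‖v‖⁻¹ * ‖g u v‖ := by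
    simp [w]
  rw [h5] at h4
  have h6 : 1 ≤ r * (‖v‖⁻¹ * ‖g u v‖) := hη1.trans (by gcongr)
  calc ‖v‖ = ‖v‖ * 1 := (mul_one _).symm
    _ ≤ ‖v‖ * (r * (‖v‖⁻¹ * ‖g u v‖)) := by gcongr
    _ = _ := by field_simp

end DualSpaces

/-! ### James' construction and its converse. -/

section WideSequencesFromBidual

variable {𝕜 : Type*} [RCLike 𝕜] {E F : Type*} [NormedAddCommGroup E] [NormedSpace 𝕜 E]
  [NormedAddCommGroup F] [NormedSpace 𝕜 F]

theorem IsWideS.mono {L L' : ℝ} (hL : L ≤ L') {n : ℕ} {b : Fin n → E} (hb : IsWideS 𝕜 L b) :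
    IsWideS 𝕜 L' b where
  basic k c := (hb.basic k c).trans (by gcongr)
  norm_le j := (hb.norm_le j).trans hL
  tail_le k c := (hb.tail_le k c).trans (by gcongr)

/-- James' construction: if a point `G` of the unit ball of the bidual has distance at least
`1 / M` from the space and is approximated by elements of `Q`, then `Q` contains a sequence
with uniformly bounded tail functionals and uniformly bounded functionals norming the initial
spans and vanishing on the tails. -/
theorem exists_seq_tail_functionals {G : StrongDual 𝕜 (StrongDual 𝕜 E)} (hG1 : ‖G‖ ≤ 1)
    {M r s : ℝ} (hM : 0 ≤ M) (hr : M < r) (hs : 1 < s)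
    (hG : ∀ x : E, 1 ≤ M * ‖G - NormedSpace.inclusionInDoubleDual 𝕜 E x‖) {Q : Set E}
    (hQ : ∀ Φ : Finset (StrongDual 𝕜 E), ∃ z ∈ Q, ∀ φ ∈ Φ, φ z = G φ) :
    ∃ b : ℕ → E, (∀ i, b i ∈ Q) ∧
      (∀ k, ∃ f : StrongDual 𝕜 E, ‖f‖ ≤ r ∧ (∀ j < k, f (b j) = 0) ∧ ∀ j, k ≤ j → f (b j) = 1) ∧
      ∀ k, ∀ v ∈ Submodule.span 𝕜 (b '' Set.Iio k), ∃ h : StrongDual 𝕜 E,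
        ‖h‖ ≤ 1 + r ∧ (∀ j, k ≤ j → h (b j) = 0) ∧ ‖v‖ ≤ s * ‖h v‖ := by
  classical
  -- Each stage records the earlier vectors, the new vector and the functionals on which this and
  -- all later vectors must agree with `G`.
  obtain ⟨a, ha, hab⟩ := exists_seq_of_forall_finset_exists
    (α := Finset E × E × Finset (StrongDual 𝕜 E))
    (fun x => x.2.1 ∈ Q ∧ (∀ φ ∈ x.2.2, φ x.2.1 = G φ) ∧
      (∃ f ∈ x.2.2, ‖f‖ ≤ r ∧ G f = 1 ∧ ∀ v ∈ x.1, f v = 0) ∧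
      ∀ v ∈ Submodule.span 𝕜 (x.1 : Set E), ∃ h ∈ x.2.2,
        ‖h‖ ≤ 1 + r ∧ G h = 0 ∧ ‖v‖ ≤ s * ‖h v‖)
    (fun x y => x.2.1 ∈ y.1 ∧ ∀ φ ∈ x.2.2, φ y.2.1 = G φ) (by
      intro A _
      obtain ⟨f, hfr, hGf, hf⟩ := exists_norm_lt_forall_mem_finset_apply_eq_zero hM hr hG
        (A.image fun x => x.2.1)
      obtain ⟨Γ, hΓ⟩ := exists_finset_norm_le_mul_norm_apply (𝕜 := 𝕜)
        (A.image fun x => x.2.1) hs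
      -- Since `f` vanishes on the earlier vectors, `g - G g • f` norms their span as well as `g`
      -- does, and `G` kills it. Later vectors, imitating `G`, are then killed too.
      let Φ := insert f (Γ.image fun g => g - G g • f)
      obtain ⟨z, hzQ, hz⟩ := hQ (Φ ∪ A.biUnion fun x => x.2.2)
      refine ⟨(A.image fun x => x.2.1, z, Φ), ⟨hzQ,
        fun φ hφ => hz φ (Finset.mem_union_left _ hφ),
        ⟨f, Finset.mem_insert_self _ _, hfr.le, hGf, hf⟩, fun v hv => ?_⟩, fun x hx =>
        ⟨Finset.mem_image_of_mem _ hx, fun φ hφ => hz φ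
          (Finset.mem_union_right _ (Finset.mem_biUnion.2 ⟨x, hx, hφ⟩))⟩⟩
      obtain ⟨g, hgΓ, hg1, hgv⟩ := hΓ v hv
      have hfv : f v = 0 := by
        have hle : Submodule.span 𝕜 ((A.image fun x => x.2.1 : Finset E) : Set E) ≤
            (f : E →ₗ[𝕜] 𝕜).ker := Submodule.span_le.2 fun w hw => hf w hw
        exact hle hv
      refine ⟨g - G g • f, Finset.mem_insert_of_mem (Finset.mem_image_of_mem _ hgΓ), ?_, ?_, ?_⟩
      · calc ‖g - G g • f‖ ≤ ‖g‖ + ‖G g‖ * ‖f‖ := by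
              rw [← norm_smul]; exact norm_sub_le _ _
          _ ≤ 1 + 1 * r := by
              have : ‖G g‖ ≤ 1 := (G.le_opNorm g).trans (mul_le_one₀ hG1 (norm_nonneg _) hg1)
              gcongr
          _ = 1 + r := by rw [one_mul]
      · simp [hGf]
      · simpa [hfv] using hgv)
  refine ⟨fun i => (a i).2.1, fun i => (ha i).1, fun k => ?_, fun k v hv => ?_⟩
  · obtain ⟨f, hfΦ, hfr, hGf, hf⟩ := (ha k).2.2.1
    refine ⟨f, hfr, fun j hj => hf _ (hab j k hj).1, fun j hj => ?_⟩
    rw [← hGf]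
    rcases hj.eq_or_lt with rfl | hj
    · exact (ha k).2.1 f hfΦ
    · exact (hab k j hj).2 f hfΦ
  · have hsub : (fun i => (a i).2.1) '' Set.Iio k ⊆ ((a k).1 : Set E) := by
      rintro _ ⟨j, hj, rfl⟩
      exact (hab j k hj).1
    obtain ⟨h, hhΦ, hhr, hGh, hh⟩ := (ha k).2.2.2 v (Submodule.span_mono hsub hv)
    refine ⟨h, hhr, fun j hj => ?_, hh⟩
    rw [← hGh]
    rcases hj.eq_or_lt with rfl | hj
    · exact (ha k).2.1 h hhΦ
    · exact (hab k j hj).2 h hhΦ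

/-- Applied to a combination, `f` reads off a tail sum, while `h` sees only the initial segment; the
latter gives the basis constant `s * (1 + r)`. -/
theorem isWideS_of_tail_functionals {b : ℕ → E} {r s L : ℝ} (hs : 0 ≤ s) (hr : r ≤ L)
    (hrs : s * (1 + r) ≤ 2 * L) (hb : ∀ i, ‖b i‖ ≤ L)
    (hf : ∀ k, ∃ f : StrongDual 𝕜 E, ‖f‖ ≤ r ∧ (∀ j < k, f (b j) = 0) ∧
      ∀ j, k ≤ j → f (b j) = 1)
    (hh : ∀ k, ∀ v ∈ Submodule.span 𝕜 (b '' Set.Iio k), ∃ h : StrongDual 𝕜 E,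
        ‖h‖ ≤ 1 + r ∧ (∀ j, k ≤ j → h (b j) = 0) ∧ ‖v‖ ≤ s * ‖h v‖) (n : ℕ) :
    IsWideS 𝕜 L fun i : Fin n => b i where
  basic k c := by
    -- The segment `Iic k` contains `b k`, hence the index `k + 1`.
    obtain ⟨h, hhr, hh0, hhv⟩ := hh (k + 1) (∑ j ∈ Finset.Iic k, c j • b j)
      (Submodule.sum_mem _ fun j hj => Submodule.smul_mem _ _ (Submodule.subset_span
        ⟨(j : ℕ), Nat.lt_succ_of_le (Fin.le_def.1 (Finset.mem_Iic.1 hj)), rfl⟩))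
    have hsum : h (∑ j ∈ Finset.Iic k, c j • b j) = h (∑ j, c j • b j) := by
      rw [map_sum, map_sum]
      refine Finset.sum_subset (Finset.subset_univ _) fun j _ hj => ?_
      have hkj : k < j := by simpa using hj
      rw [map_smul, hh0 j hkj, smul_zero]
    rw [hsum] at hhv
    calc _ ≤ s * ‖h (∑ j, c j • b j)‖ := hhv
      _ ≤ s * ((1 + r) * ‖∑ j, c j • b j‖) := by
        gcongr
        exact h.le_of_opNorm_le hhr _
      _ = s * (1 + r) * ‖∑ j, c j • b j‖ := by ring
      _ ≤ _ := by gcongr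
  norm_le j := hb j
  tail_le k c := by
    obtain ⟨f, hfr, hf0, hf1⟩ := hf k
    have hsum : f (∑ j, c j • b j) = ∑ j ∈ Finset.Ici k, c j := by
      rw [map_sum, ← Finset.sum_subset (Finset.subset_univ (Finset.Ici k))]
      · refine Finset.sum_congr rfl fun j hj => ?_
        rw [map_smul, hf1 j (Fin.le_def.1 (Finset.mem_Ici.1 hj)), smul_eq_mul, mul_one]
      · intro j _ hj
        have hkj : j < k := by simpa using hj
        rw [map_smul, hf0 j hkj, smul_zero]
    rw [← hsum]
    exact f.le_of_opNorm_le (hfr.trans hr) _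

/-- The set `Q` carries the extra demand on the vectors: nearly constant image in one application,
norm one in the other. -/
theorem exists_seq_isWideS {G : StrongDual 𝕜 (StrongDual 𝕜 E)} (hG1 : ‖G‖ ≤ 1) {ε : ℝ}
    (hε : 0 < ε)
    (hG : ∀ x : E, 1 ≤ (1 + ε / 4) * ‖G - NormedSpace.inclusionInDoubleDual 𝕜 E x‖) {Q : Set E}
    (hQ1 : ∀ z ∈ Q, ‖z‖ ≤ 1)
    (hQ : ∀ Φ : Finset (StrongDual 𝕜 E), ∃ z ∈ Q, ∀ φ ∈ Φ, φ z = G φ) :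
    ∃ b : ℕ → E, (∀ i, b i ∈ Q) ∧ ∀ n, IsWideS 𝕜 (1 + ε) fun i : Fin n => b i := by
  -- With `r = 1 + ε / 2` this `s` solves `s * (1 + r) = 2 * (1 + ε)`.
  have hs : 1 < (2 + 2 * ε) / (2 + ε / 2) := by rw [one_lt_div (by positivity)]; linarith
  obtain ⟨b, hbQ, hf, hh⟩ := exists_seq_tail_functionals hG1 (by positivity : 0 ≤ 1 + ε / 4)
    (by linarith : 1 + ε / 4 < 1 + ε / 2) hs hG hQ
  refine ⟨b, hbQ, isWideS_of_tail_functionals (by positivity) (by linarith) ?_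
    (fun i => (hQ1 _ (hbQ i)).trans (by linarith)) hf hh⟩
  apply le_of_eq
  field_simp
  ring

/-- A point of a dual space outside an isometric copy of a Banach space can be translated and rescaled to lie in
the unit ball at distance almost one from the copy. -/
theorem exists_smul_sub_norm_lt_one [CompleteSpace E] {ι : E →L[𝕜] StrongDual 𝕜 F}
    (hι : Isometry ι) {G : StrongDual 𝕜 F} (hG : G ∉ Set.range ι) {M : ℝ} (hM : 1 < M) :
    ∃ (a : 𝕜) (x : E), ‖a • (G - ι x)‖ < 1 ∧ ∀ z : E, 1 ≤ M * ‖a • (G - ι x) - ι z‖ := by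
  have hcl : IsClosed (Set.range ι) := hι.isClosedEmbedding.isClosed_range
  have hne : (Set.range ι).Nonempty := ⟨_, 0, rfl⟩
  let d := Metric.infDist G (Set.range ι)
  have hd : 0 < d := (hcl.notMem_iff_infDist_pos hne).1 hG
  -- For an almost nearest point `x`, division of `G - ι x` by `M * d` brings the norm below 1 and
  -- leaves distance `1 / M` to the copy.
  obtain ⟨_, ⟨x, rfl⟩, hx⟩ := (Metric.infDist_lt_iff hne (x := G) (r := M * d)).1 (by
    change d < M * d; nlinarith)
  have hMd : 0 < M * d := by positivity
  have ha : ((M * d : ℝ) : 𝕜) ≠ 0 := by exact_mod_cast hMd.ne'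
  refine ⟨(((M * d)⁻¹ : ℝ) : 𝕜), x, ?_, fun z => ?_⟩
  · rw [norm_smul, RCLike.norm_ofReal, abs_of_pos (by positivity), inv_mul_lt_one₀ hMd,
      ← dist_eq_norm]
    exact hx
  · have h1 : (((M * d)⁻¹ : ℝ) : 𝕜) • (G - ι x) - ι z =
        (((M * d)⁻¹ : ℝ) : 𝕜) • (G - ι (x + ((M * d : ℝ) : 𝕜) • z)) := by
      rw [map_add, map_smul, smul_sub, smul_sub, smul_add, RCLike.ofReal_inv, inv_smul_smul₀ ha]
      abel
    change 1 ≤ M * ‖(((M * d)⁻¹ : ℝ) : 𝕜) • (G - ι x) - ι z‖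
    rw [h1, norm_smul, RCLike.norm_ofReal, abs_of_pos (by positivity), ← dist_eq_norm]
    have h2 : d ≤ dist G (ι (x + ((M * d : ℝ) : 𝕜) • z)) := Metric.infDist_le_dist_of_mem ⟨_, rfl⟩
    calc 1 = M * ((M * d)⁻¹ * d) := by field_simp
      _ ≤ _ := by gcongr

theorem exists_smul_sub_inclusion_norm_lt_one [CompleteSpace E]
    {G : StrongDual 𝕜 (StrongDual 𝕜 E)}
    (hG : G ∉ Set.range (NormedSpace.inclusionInDoubleDual 𝕜 E)) {M : ℝ} (hM : 1 < M) :
    ∃ (a : 𝕜) (x : E), ‖a • (G - NormedSpace.inclusionInDoubleDual 𝕜 E x)‖ < 1 ∧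
      ∀ z : E, 1 ≤ M * ‖a • (G - NormedSpace.inclusionInDoubleDual 𝕜 E x) -
        NormedSpace.inclusionInDoubleDual 𝕜 E z‖ :=
  exists_smul_sub_norm_lt_one (ι := NormedSpace.inclusionInDoubleDual 𝕜 E)
    (NormedSpace.inclusionInDoubleDualLi 𝕜 (E := E)).isometry hG hM

/-- An operator that is not Tauberian maps some `(1 + ε)`-wide-(s) sequence to a set of small
diameter. -/
theorem exists_seq_isWideS_of_not_isTauberian [CompleteSpace E] {S : E →L[𝕜] F}
    (hS : ¬ IsTauberian S) {ε : ℝ} (hε : 0 < ε) :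
    ∃ b : ℕ → E, (∀ n, IsWideS 𝕜 (1 + ε) fun i : Fin n => b i) ∧
      ∀ i j, ‖S (b i) - S (b j)‖ < ε := by
  simp only [IsTauberian, not_forall, not_not] at hS
  obtain ⟨G, hG, y, hy⟩ := hS
  obtain ⟨a, x, h1, h2⟩ := exists_smul_sub_inclusion_norm_lt_one hG (by linarith : 1 < 1 + ε / 4)
  have hy' : dualOperator (dualOperator S) (a • (G - NormedSpace.inclusionInDoubleDual 𝕜 E x)) =
      NormedSpace.inclusionInDoubleDual 𝕜 F (a • (y - S x)) := by
    rw [map_smul, map_sub, ← hy, map_smul, map_sub]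
    rfl
  obtain ⟨b, hbQ, hb⟩ := exists_seq_isWideS h1.le hε h2 (Q := {z | ‖z‖ ≤ 1 ∧
      ‖S z - a • (y - S x)‖ < ε / 2}) (fun z hz => hz.1)
    (exists_norm_lt_one_forall_mem_finset_norm_sub_lt h1 hy' (half_pos hε))
  refine ⟨b, hb, fun i j => ?_⟩
  have := norm_sub_le (S (b i) - a • (y - S x)) (S (b j) - a • (y - S x))
  rw [sub_sub_sub_cancel_right] at this
  linarith [(hbQ i).2, (hbQ j).2]

/-- The unit sphere of a non-reflexive Banach space contains `(1 + ε)`-wide-(s) sequences. -/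
theorem exists_seq_isWideS_norm_eq_one [CompleteSpace E] {G : StrongDual 𝕜 (StrongDual 𝕜 E)}
    (hG : G ∉ Set.range (NormedSpace.inclusionInDoubleDual 𝕜 E)) {ε : ℝ} (hε : 0 < ε) :
    ∃ b : ℕ → E, (∀ n, IsWideS 𝕜 (1 + ε) fun i : Fin n => b i) ∧ ∀ i, ‖b i‖ = 1 := by
  obtain ⟨a, x, h1, h2⟩ := exists_smul_sub_inclusion_norm_lt_one hG (by linarith : 1 < 1 + ε / 4)
  have h3 : a • (G - NormedSpace.inclusionInDoubleDual 𝕜 E x) ∉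
      Set.range (NormedSpace.inclusionInDoubleDual 𝕜 E) := by
    rintro ⟨z, hz⟩
    have := h2 z
    rw [norm_eq_zero.2 (sub_eq_zero.2 hz.symm), mul_zero] at this
    linarith
  obtain ⟨b, hbQ, hb⟩ := exists_seq_isWideS h1.le hε h2 (Q := {z | ‖z‖ = 1})
    (fun z hz => le_of_eq hz) (exists_norm_eq_one_forall_mem_finset h1 h3)
  exact ⟨b, hb, hbQ⟩

/-- The functional `c ↦ ∑ j ≥ k, c j` on finitely supported sequences. -/
noncomputable def tailSum (𝕜 : Type*) [RCLike 𝕜] (k : ℕ) : (ℕ →₀ 𝕜) →ₗ[𝕜] 𝕜 :=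
  Finsupp.linearCombination 𝕜 fun j => if k ≤ j then 1 else 0

/-- A bounded sequence with uniformly bounded tail sums has weak* limit points outside the
space. -/
theorem exists_tendsto_notMem_range_inclusion {b : ℕ → E} {C L : ℝ} (hC : ∀ i, ‖b i‖ ≤ C)
    (hb : ∀ k c, ‖tailSum 𝕜 k c‖ ≤ L * ‖Finsupp.linearCombination 𝕜 b c‖) :
    ∃ G : StrongDual 𝕜 (StrongDual 𝕜 E),
      G ∉ Set.range (NormedSpace.inclusionInDoubleDual 𝕜 E) ∧
      ∀ f : StrongDual 𝕜 E, Tendsto (fun i => f (b i)) (hyperfilter ℕ) (𝓝 (G f)) := by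
  classical
  let _ : NormedSpace ℝ E := NormedSpace.restrictScalars ℝ 𝕜 E
  obtain ⟨G, -, hG⟩ := (WeakDual.isCompact_closedBall (𝕜 := 𝕜) (E := StrongDual 𝕜 E) 0
    C).ultrafilter_le_nhds ((hyperfilter ℕ).map fun i => StrongDual.toWeakDual
      (NormedSpace.inclusionInDoubleDual 𝕜 E (b i))) (by
      rw [le_principal_iff]
      refine Ultrafilter.mem_map.2 (Filter.univ_mem' fun i => ?_)
      simpa using (NormedSpace.double_dual_bound 𝕜 E (b i)).trans (hC i))
  have hlim : ∀ f : StrongDual 𝕜 E, Tendsto (fun i => f (b i)) (hyperfilter ℕ) (𝓝 (G f)) :=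
    fun f => ((WeakDual.eval_continuous f).tendsto G).comp hG
  refine ⟨WeakDual.toStrongDual G, ?_, hlim⟩
  rintro ⟨x, hx⟩
  have hxlim : ∀ f : StrongDual 𝕜 E, Tendsto (fun i => f (b i)) (hyperfilter ℕ) (𝓝 (f x)) := by
    intro f
    have : f x = G f := congrArg (fun H => H f) hx
    rw [this]
    exact hlim f
  have hreal : ∀ (a : ℝ) (z : E), a • z = (a : 𝕜) • z :=
    fun a z => RCLike.real_smul_eq_coe_smul a z
  -- Mazur's argument: `x` is a weak limit of the `b i` with `i ≥ m`, each of which belongs to this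
  -- convex set.
  have hclos : ∀ m, x ∈ closure (Finsupp.linearCombination 𝕜 b '' {c | tailSum 𝕜 m c = 1}) := by
    intro m
    by_contra hn
    have hconv : Convex ℝ (Finsupp.linearCombination 𝕜 b '' {c | tailSum 𝕜 m c = 1}) := by
      rintro _ ⟨c, hc, rfl⟩ _ ⟨c', hc', rfl⟩ p q hp hq hpq
      refine ⟨(p : 𝕜) • c + (q : 𝕜) • c', ?_, ?_⟩
      · rw [Set.mem_ofPred_eq] at hc hc' ⊢
        rw [map_add, map_smul, map_smul, hc, hc', ← add_smul, ← RCLike.ofReal_add, hpq]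
        simp
      · rw [map_add, map_smul, map_smul, hreal, hreal]
    obtain ⟨f, u, hfu, hux⟩ := RCLike.geometric_hahn_banach_closed_point (𝕜 := 𝕜) hconv.closure
      isClosed_closure hn
    have hle : RCLike.re (f x) ≤ u := by
      refine le_of_tendsto ((RCLike.continuous_re.tendsto _).comp (hxlim f)) ?_
      have hm : ∀ᶠ i in (hyperfilter ℕ : Filter ℕ), m ≤ i :=
        Nat.hyperfilter_le_atTop (eventually_ge_atTop m)
      filter_upwards [hm] with i hi
      refine (hfu (b i) (subset_closure ⟨Finsupp.single i 1, ?_, ?_⟩)).le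
      · simp [tailSum, hi]
      · simp
    exact not_lt_of_ge hle hux
  -- Two combinations within `η` of `x` are compared: a finitely supported `c` and then a `c'` with
  -- tail sum 1 beyond the support of `c`. Their difference has tail sum 1 but norm below `2 * η`.
  obtain ⟨η, hη, hη1⟩ : ∃ η : ℝ, 0 < η ∧ |L| * (2 * η) < 1 :=
    ⟨1 / (2 * (|L| + 1)), by positivity, by
      rw [← sub_pos]
      have : 1 - |L| * (2 * (1 / (2 * (|L| + 1)))) = 1 / (|L| + 1) := by field_simp; ring
      rw [this]; positivity⟩
  obtain ⟨_, ⟨c, -, rfl⟩, hc⟩ := Metric.mem_closure_iff.1 (hclos 0) η hη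
  obtain ⟨m, hm⟩ : ∃ m, tailSum 𝕜 m c = 0 := by
    refine ⟨c.support.sup id + 1, ?_⟩
    rw [tailSum, Finsupp.linearCombination_apply, Finsupp.sum]
    refine Finset.sum_eq_zero fun j hj => ?_
    have : j ≤ c.support.sup id := Finset.le_sup (f := id) hj
    rw [if_neg (by omega), smul_zero]
  obtain ⟨_, ⟨c', hc', rfl⟩, hcc⟩ := Metric.mem_closure_iff.1 (hclos m) η hη
  have h1 := hb m (c' - c)
  rw [map_sub, map_sub, hm, hc', sub_zero, norm_one, ← dist_eq_norm] at h1
  have h2 := dist_triangle_left (Finsupp.linearCombination 𝕜 b c')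
    (Finsupp.linearCombination 𝕜 b c) x
  have h3 : L * dist (Finsupp.linearCombination 𝕜 b c') (Finsupp.linearCombination 𝕜 b c) ≤
      |L| * (2 * η) := by
    gcongr
    · exact le_abs_self L
    · linarith
  linarith

end WideSequencesFromBidual

/-! ### Abel summation between wide-(s) and wide-(c) sequences. -/

section Differences

variable {𝕜 : Type*} [RCLike 𝕜] {E F : Type*} [NormedAddCommGroup E] [NormedSpace 𝕜 E]
  [NormedAddCommGroup F] [NormedSpace 𝕜 F]

theorem sum_Iic_fin_eq_sum_range {M : Type*} [AddCommMonoid M] {n : ℕ} (f : ℕ → M) (k : Fin n) :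
    ∑ j ∈ Finset.Iic k, f j = ∑ j ∈ Finset.range (k + 1), f j := by
  have h := Finset.sum_map (Finset.Iic k) Fin.valEmbedding f
  have hk : Finset.range (k + 1) = Finset.Iic (k : ℕ) := by
    ext j
    simp
  rw [Fin.map_valEmbedding_Iic] at h
  rw [hk]
  exact h.symm

theorem sum_Ici_fin_eq_sum_Ico {M : Type*} [AddCommMonoid M] {n : ℕ} (f : ℕ → M) (k : Fin n) :
    ∑ j ∈ Finset.Ici k, f j = ∑ j ∈ Finset.Ico (k : ℕ) n, f j := by
  have h := Finset.sum_map (Finset.Ici k) Fin.valEmbedding f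
  rw [Fin.map_valEmbedding_Ici] at h
  exact h.symm

theorem isFiniteBasic_iff_nat {L : ℝ} {n : ℕ} {b : ℕ → E} :
    IsFiniteBasic 𝕜 L (fun i : Fin n => b i) ↔ ∀ k < n, ∀ c : ℕ → 𝕜,
      ‖∑ j ∈ Finset.range (k + 1), c j • b j‖ ≤ L * ‖∑ j ∈ Finset.range n, c j • b j‖ := by
  constructor
  · intro h k hk c
    have := h ⟨k, hk⟩ fun j => c j
    rwa [sum_Iic_fin_eq_sum_range (fun j => c j • b j) ⟨k, hk⟩,
      Fin.sum_univ_eq_sum_range (fun j => c j • b j)] at this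
  · intro h k c
    have := h k k.2 (Function.extend Fin.val c 0)
    rw [← sum_Iic_fin_eq_sum_range (fun j => Function.extend Fin.val c 0 j • b j),
      ← Fin.sum_univ_eq_sum_range (fun j => Function.extend Fin.val c 0 j • b j)] at this
    simpa only [Fin.val_injective.extend_apply] using this

theorem isWideS_iff_nat {L : ℝ} {n : ℕ} {b : ℕ → E} :
    IsWideS 𝕜 L (fun i : Fin n => b i) ↔
      (∀ k < n, ∀ c : ℕ → 𝕜, ‖∑ j ∈ Finset.range (k + 1), c j • b j‖ ≤
        2 * L * ‖∑ j ∈ Finset.range n, c j • b j‖) ∧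
      (∀ k < n, ‖b k‖ ≤ L) ∧
      ∀ k < n, ∀ c : ℕ → 𝕜, ‖∑ j ∈ Finset.Ico k n, c j‖ ≤
        L * ‖∑ j ∈ Finset.range n, c j • b j‖ := by
  constructor
  · intro h
    refine ⟨isFiniteBasic_iff_nat.1 h.basic, fun k hk => h.norm_le ⟨k, hk⟩, fun k hk c => ?_⟩
    have := h.tail_le ⟨k, hk⟩ fun j => c j
    rwa [sum_Ici_fin_eq_sum_Ico c ⟨k, hk⟩,
      Fin.sum_univ_eq_sum_range (fun j => c j • b j)] at this
  · rintro ⟨h1, h2, h3⟩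
    refine ⟨isFiniteBasic_iff_nat.2 h1, fun j => h2 j j.2, fun k c => ?_⟩
    have := h3 k k.2 (Function.extend Fin.val c 0)
    rw [← sum_Ici_fin_eq_sum_Ico (Function.extend Fin.val c 0),
      ← Fin.sum_univ_eq_sum_range (fun j => Function.extend Fin.val c 0 j • b j)] at this
    simpa only [Fin.val_injective.extend_apply] using this

theorem exists_nat_extension {n : ℕ} (b : Fin n → E) :
    ∃ b' : ℕ → E, (b = fun i : Fin n => b' i) ∧ ∀ j, n ≤ j → b' j = 0 :=
  ⟨Function.extend Fin.val b 0, funext fun i => (Fin.val_injective.extend_apply b 0 i).symm,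
    fun j hj => Function.extend_apply' _ _ _ (by rintro ⟨i, rfl⟩; exact absurd i.2 (by omega))⟩

/-- Abel summation; `Nat.casesOn j 0 c` is the shifted coefficient `c (j - 1)`, with value 0 at `j =
0`. -/
theorem sum_range_smul_sub_succ (c : ℕ → 𝕜) (b : ℕ → E) (k : ℕ) :
    ∑ i ∈ Finset.range (k + 1), c i • (b (i + 1) - b i) =
      ∑ j ∈ Finset.range (k + 1), (Nat.casesOn j 0 c - c j) • b j + c k • b (k + 1) := by
  induction k with
  | zero => simp [smul_sub]; abel
  | succ k ih =>
    rw [Finset.sum_range_succ, ih, Finset.sum_range_succ _ (k + 1)]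
    simp only [smul_sub, sub_smul]
    abel

theorem sum_Ico_sub_succ (c : ℕ → 𝕜) {k n : ℕ} (hk : k ≤ n) :
    ∑ j ∈ Finset.Ico (k + 1) (n + 1), ((Nat.casesOn j 0 c : 𝕜) - c j) = c k - c n := by
  rw [← Finset.sum_Ico_add' (fun j => ((Nat.casesOn j 0 c : 𝕜) - c j)) k n 1]
  have := Finset.sum_Ico_sub c hk
  rw [← neg_sub (c n), ← this, ← Finset.sum_neg_distrib]
  exact Finset.sum_congr rfl fun j _ => by simp

/-- In terms of `b` the coefficients are `c (j - 1) - c j`, whose tail sum from `k + 1` telescopes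
to `c k`; hence `|c k|` is at most `L` times the norm. An initial segment is one of `b` plus `c k •
b (k + 1)`, which costs `2 * L + L * L`. -/
theorem IsWideS.isWideC_sub {L : ℝ} (hL : 1 ≤ L) {n : ℕ} {b : ℕ → E}
    (hb : IsWideS 𝕜 L fun i : Fin (n + 1) => b i) :
    IsWideC 𝕜 (2 * L + L ^ 2) fun i : Fin n => b (i + 1) - b i := by
  obtain ⟨h1, h2, h3⟩ := isWideS_iff_nat.1 hb
  have key : ∀ k < n, ∀ c : ℕ → 𝕜,
      ‖∑ j ∈ Finset.range (k + 1), c j • (b (j + 1) - b j)‖ ≤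
        (2 * L + L ^ 2) * ‖∑ j ∈ Finset.range n, c j • (b (j + 1) - b j)‖ ∧
      ‖c k‖ ≤ L * ‖∑ j ∈ Finset.range n, c j • (b (j + 1) - b j)‖ := by
    intro k hk c
    -- Cutting off at `n` makes the boundary term of the summation by parts vanish.
    let c' : ℕ → 𝕜 := fun j => if j < n then c j else 0
    have hc' : ∀ j < n, c' j = c j := fun j hj => if_pos hj
    have hc'n : c' n = 0 := if_neg (lt_irrefl n)
    have e1 : ∑ j ∈ Finset.range n, c j • (b (j + 1) - b j) =
        ∑ j ∈ Finset.range (n + 1), ((Nat.casesOn j 0 c' : 𝕜) - c' j) • b j := by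
      have := sum_range_smul_sub_succ c' b n
      rw [hc'n, zero_smul, add_zero, Finset.sum_range_succ, hc'n, zero_smul, add_zero] at this
      rw [← this]
      exact Finset.sum_congr rfl fun j hj => by rw [hc' j (Finset.mem_range.1 hj)]
    have e2 : ∑ j ∈ Finset.range (k + 1), c j • (b (j + 1) - b j) =
        ∑ j ∈ Finset.range (k + 1), ((Nat.casesOn j 0 c' : 𝕜) - c' j) • b j +
          c k • b (k + 1) := by
      rw [← hc' k hk, ← sum_range_smul_sub_succ c' b k]
      exact Finset.sum_congr rfl fun j hj => by
        rw [hc' j (by have := Finset.mem_range.1 hj; omega)]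
    have e3 : ‖c k‖ ≤ L * ‖∑ j ∈ Finset.range n, c j • (b (j + 1) - b j)‖ := by
      have := h3 (k + 1) (by omega) fun j => (Nat.casesOn j 0 c' : 𝕜) - c' j
      rwa [sum_Ico_sub_succ c' hk.le, hc'n, sub_zero, hc' k hk, ← e1] at this
    refine ⟨?_, e3⟩
    have e4 := h1 k (by omega) fun j => (Nat.casesOn j 0 c' : 𝕜) - c' j
    rw [← e1] at e4
    rw [e2]
    calc _ ≤ _ := norm_add_le _ _
      _ ≤ 2 * L * ‖∑ j ∈ Finset.range n, c j • (b (j + 1) - b j)‖ +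
          L * ‖∑ j ∈ Finset.range n, c j • (b (j + 1) - b j)‖ * L := by
        rw [norm_smul]
        gcongr
        exact h2 _ (by omega)
      _ = _ := by ring
  refine ⟨isFiniteBasic_iff_nat.2 fun k hk c => (key k hk c).1, fun k => ?_, fun k => ?_⟩
  · have := (key k k.2 (Pi.single (k : ℕ) 1)).2
    rw [Finset.sum_eq_single (k : ℕ) (fun j _ hj => by simp [hj])
      (fun h => absurd (Finset.mem_range.2 k.2) h)] at this
    simp only [Pi.single_eq_same, norm_one, one_smul] at this
    rw [div_le_iff₀ (by positivity)]
    nlinarith [norm_nonneg (b (k + 1) - b k)]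
  · rw [sum_Iic_fin_eq_sum_range (fun j => b (j + 1) - b j), Finset.sum_range_sub]
    have := norm_sub_le (b (k + 1)) (b 0)
    have := h2 (k + 1) (by omega)
    have := h2 0 (by omega)
    nlinarith

theorem sum_range_smul_sum_range (c : ℕ → 𝕜) (e : ℕ → E) (m : ℕ) :
    ∑ j ∈ Finset.range m, c j • ∑ i ∈ Finset.range (j + 1), e i =
      ∑ i ∈ Finset.range m, (∑ j ∈ Finset.Ico i m, c j) • e i := by
  simp only [Finset.smul_sum, Finset.sum_smul]
  refine Finset.sum_comm' fun x y => ?_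
  simp only [Finset.mem_range, Finset.mem_Ico]
  omega

/-- The coefficient of `e i` is the tail sum from `i`. Subtracting consecutive basis projections
bounds it by `2 * L ^ 2` times the norm. An initial segment is a basis projection minus a tail sum
times a partial sum of `e`, so its constant is `L + 2 * L ^ 3`. -/
theorem IsWideC.isWideS_sum {L : ℝ} (hL : 1 ≤ L) {n : ℕ} {e : ℕ → E}
    (he : IsWideC 𝕜 L fun i : Fin n => e i) :
    IsWideS 𝕜 (2 * L ^ 3) fun i : Fin n => ∑ j ∈ Finset.range (i + 1), e j := by
  have h1 := isFiniteBasic_iff_nat.1 he.basic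
  have h2 : ∀ k < n, 1 ≤ L * ‖e k‖ := fun k hk => by
    have := he.le_norm ⟨k, hk⟩
    rwa [div_le_iff₀ (by positivity), mul_comm] at this
  have h3 : ∀ k < n, ‖∑ j ∈ Finset.range (k + 1), e j‖ ≤ L := fun k hk => by
    have := he.norm_sum_le ⟨k, hk⟩
    rwa [sum_Iic_fin_eq_sum_range e ⟨k, hk⟩] at this
  have hL3 : L ≤ L ^ 3 := le_self_pow₀ hL (by norm_num)
  have hL2 : L ^ 2 ≤ L ^ 3 := pow_le_pow_right₀ hL (by norm_num)
  have htail : ∀ k < n, ∀ c : ℕ → 𝕜, ‖∑ j ∈ Finset.Ico k n, c j‖ ≤ 2 * L ^ 2 *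
      ‖∑ j ∈ Finset.range n, c j • ∑ i ∈ Finset.range (j + 1), e i‖ := by
    intro k hk c
    rw [sum_range_smul_sum_range]
    set v := ∑ i ∈ Finset.range n, (∑ j ∈ Finset.Ico i n, c j) • e i
    have hk1 := h1 k hk fun i => ∑ j ∈ Finset.Ico i n, c j
    have hk0 : ‖∑ i ∈ Finset.range k, (∑ j ∈ Finset.Ico i n, c j) • e i‖ ≤ L * ‖v‖ := by
      rcases k with _ | k
      · simp only [Finset.range_zero, Finset.sum_empty, norm_zero]
        positivity
      · exact h1 k (by omega) fun i => ∑ j ∈ Finset.Ico i n, c j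
    rw [Finset.sum_range_succ] at hk1
    have h4 : ‖(∑ j ∈ Finset.Ico k n, c j) • e k‖ ≤ 2 * L * ‖v‖ := by
      have := norm_sub_le (∑ i ∈ Finset.range k, (∑ j ∈ Finset.Ico i n, c j) • e i +
        (∑ j ∈ Finset.Ico k n, c j) • e k)
        (∑ i ∈ Finset.range k, (∑ j ∈ Finset.Ico i n, c j) • e i)
      rw [add_sub_cancel_left] at this
      linarith
    rw [norm_smul] at h4
    calc ‖∑ j ∈ Finset.Ico k n, c j‖ = ‖∑ j ∈ Finset.Ico k n, c j‖ * 1 := (mul_one _).symm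
      _ ≤ ‖∑ j ∈ Finset.Ico k n, c j‖ * (L * ‖e k‖) := by gcongr; exact h2 k hk
      _ = L * (‖∑ j ∈ Finset.Ico k n, c j‖ * ‖e k‖) := by ring
      _ ≤ L * (2 * L * ‖v‖) := by gcongr
      _ = _ := by ring
  refine (isWideS_iff_nat (b := fun i => ∑ j ∈ Finset.range (i + 1), e j)).2
    ⟨fun k hk c => ?_, fun k hk => (h3 k hk).trans (by linarith), fun k hk c =>
      (htail k hk c).trans (by gcongr)⟩
  have ht : ‖∑ j ∈ Finset.Ico (k + 1) n, c j‖ ≤ 2 * L ^ 2 *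
      ‖∑ j ∈ Finset.range n, c j • ∑ i ∈ Finset.range (j + 1), e i‖ := by
    rcases (Nat.succ_le_of_lt hk).eq_or_lt with h | h
    · rw [← h]; simp; positivity
    · exact htail _ h c
  have hsum : ∑ j ∈ Finset.range (k + 1), c j • ∑ i ∈ Finset.range (j + 1), e i =
      ∑ i ∈ Finset.range (k + 1), (∑ j ∈ Finset.Ico i n, c j) • e i -
        (∑ j ∈ Finset.Ico (k + 1) n, c j) • ∑ i ∈ Finset.range (k + 1), e i := by
    rw [sum_range_smul_sum_range, Finset.smul_sum, ← Finset.sum_sub_distrib]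
    refine Finset.sum_congr rfl fun i hi => ?_
    rw [← sub_smul, ← Finset.sum_Ico_consecutive c (Finset.mem_range.1 hi).le hk,
      add_sub_cancel_right]
  have hbasic := h1 k hk fun i => ∑ j ∈ Finset.Ico i n, c j
  rw [← sum_range_smul_sum_range] at hbasic
  rw [hsum]
  set v := ∑ j ∈ Finset.range n, c j • ∑ i ∈ Finset.range (j + 1), e i
  calc _ ≤ _ := norm_sub_le _ _
    _ ≤ L * ‖v‖ + 2 * L ^ 2 * ‖v‖ * L := by
      rw [norm_smul]
      gcongr
      exact h3 k hk
    _ = (L + 2 * L ^ 3) * ‖v‖ := by ring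
    _ ≤ 2 * (2 * L ^ 3) * ‖v‖ := by gcongr; linarith

theorem diam_range_lt {ι : Type*} [Finite ι] {f : ι → F} {δ ε : ℝ} (hδ : 0 ≤ δ) (hδε : δ < ε)
    (h : ∀ i j, ‖f i - f j‖ ≤ δ) : Metric.diam (Set.range f) < ε := by
  refine lt_of_le_of_lt (Metric.diam_le_of_forall_dist_le hδ ?_) hδε
  rintro _ ⟨i, rfl⟩ _ ⟨j, rfl⟩
  rw [dist_eq_norm]
  exact h i j

theorem norm_sub_lt_of_diam_range_lt {ι : Type*} [Finite ι] {f : ι → F} {ε : ℝ}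
    (h : Metric.diam (Set.range f) < ε) (i j : ι) : ‖f i - f j‖ < ε := by
  rw [← dist_eq_norm]
  exact (Metric.dist_le_diam_of_mem (Set.finite_range f).isBounded ⟨i, rfl⟩ ⟨j, rfl⟩).trans_lt h

theorem exists_isWideC_of_exists_isWideS {T : E →L[𝕜] F}
    (h : ∃ L : ℝ, 1 ≤ L ∧ ∀ (n : ℕ) (ε : ℝ), 0 < ε → ∃ b : Fin n → E,
      IsWideS 𝕜 L b ∧ Metric.diam (Set.range fun i => T (b i)) < ε) :
    ∃ L : ℝ, 1 ≤ L ∧ ∀ (n : ℕ) (ε : ℝ), 0 < ε → ∃ e : Fin n → E,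
      IsWideC 𝕜 L e ∧ ∑ i, ‖T (e i)‖ < ε := by
  obtain ⟨L, hL, h⟩ := h
  refine ⟨2 * L + L ^ 2, by nlinarith, fun n ε hε => ?_⟩
  -- One more vector than differences; the denominator `n + 1` also keeps the final inequality
  -- strict.
  obtain ⟨b, hb, hd⟩ := h (n + 1) (ε / (n + 1)) (by positivity)
  obtain ⟨b, rfl, -⟩ := exists_nat_extension b
  refine ⟨_, hb.isWideC_sub hL, ?_⟩
  calc ∑ i : Fin n, ‖T (b (i + 1) - b i)‖ ≤ ∑ _i : Fin n, ε / (n + 1) := by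
        refine Finset.sum_le_sum fun i _ => ?_
        rw [map_sub]
        exact (norm_sub_lt_of_diam_range_lt hd i.succ i.castSucc).le
    _ = n * (ε / (n + 1)) := by simp
    _ < ε := by
      have : n * (ε / (n + 1)) = ε - ε / (n + 1) := by field_simp; ring
      rw [this]
      have : 0 < ε / (n + 1) := by positivity
      linarith

theorem exists_isWideS_of_exists_isWideC {T : E →L[𝕜] F}
    (h : ∃ L : ℝ, 1 ≤ L ∧ ∀ (n : ℕ) (ε : ℝ), 0 < ε → ∃ e : Fin n → E,
      IsWideC 𝕜 L e ∧ ∑ i, ‖T (e i)‖ < ε) :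
    ∃ L : ℝ, 1 ≤ L ∧ ∀ (n : ℕ) (ε : ℝ), 0 < ε → ∃ b : Fin n → E,
      IsWideS 𝕜 L b ∧ Metric.diam (Set.range fun i => T (b i)) < ε := by
  obtain ⟨L, hL, h⟩ := h
  refine ⟨2 * L ^ 3, by nlinarith [one_le_pow₀ hL (n := 3)], fun n ε hε => ?_⟩
  obtain ⟨e, he, hs⟩ := h n (ε / 2) (half_pos hε)
  obtain ⟨e, rfl, -⟩ := exists_nat_extension e
  rw [Fin.sum_univ_eq_sum_range (fun i => ‖T (e i)‖)] at hs
  have key : ∀ i j : ℕ, i ≤ j → j < n → ‖T (∑ l ∈ Finset.range (j + 1), e l) -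
      T (∑ l ∈ Finset.range (i + 1), e l)‖ ≤ ε / 2 := by
    intro i j hij hj
    rw [← map_sub, ← Finset.sum_Ico_eq_sub _ (by omega : i + 1 ≤ j + 1), map_sum]
    refine (norm_sum_le _ _).trans (le_trans ?_ hs.le)
    refine Finset.sum_le_sum_of_subset_of_nonneg (fun l hl => ?_) fun _ _ _ => norm_nonneg _
    simp only [Finset.mem_Ico, Finset.mem_range] at hl ⊢
    omega
  refine ⟨_, he.isWideS_sum hL, diam_range_lt (half_pos hε).le (half_lt_self hε) fun i j => ?_⟩
  rcases le_total (i : ℕ) j with hij | hij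
  · rw [norm_sub_rev]
    exact key i j hij j.2
  · exact key j i hij i.2

end Differences

/-! ### Transfer between a space and its ultrapower. -/

section UltrapowerTransfer

variable {𝕜 : Type*} [RCLike 𝕜] {X Y : Type*} [NormedAddCommGroup X] [NormedSpace 𝕜 X]
  [NormedAddCommGroup Y] [NormedSpace 𝕜 Y]

/-- The norm in the ultrapower is the limit of the norms. -/
theorem tendsto_norm_ultrapower_mk (U : Ultrafilter ℕ) (x : lp (fun _ : ℕ => X) ∞) :
    Tendsto (fun m => ‖x m‖) U (𝓝 ‖(ultraNull 𝕜 X U).mkQL x‖) := by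
  classical
  obtain ⟨l, -, hl⟩ := (isCompact_Icc (a := (0 : ℝ)) (b := ‖x‖)).ultrafilter_le_nhds
    (U.map fun m => ‖x m‖) (by
      rw [le_principal_iff]
      exact Ultrafilter.mem_map.2 (Filter.univ_mem' fun m =>
        ⟨norm_nonneg _, lp.norm_apply_le_norm (by simp) x m⟩))
  have hl : Tendsto (fun m => ‖x m‖) U (𝓝 l) := hl
  have hl0 : 0 ≤ l := ge_of_tendsto' hl fun m => norm_nonneg _
  suffices h : ‖(ultraNull 𝕜 X U).mkQL x‖ = l by rwa [h]
  refine le_antisymm (le_of_forall_pos_le_add fun ε hε => ?_)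
    (le_of_forall_pos_le_add fun ε hε => ?_)
  · have hev : ∀ᶠ m in (U : Filter ℕ), ‖x m‖ < l + ε := hl.eventually_lt_const (by linarith)
    -- Replacing the large terms by 0 changes the sequence only off a set of `U`, so the class has a
    -- representative of norm at most `l + ε`.
    let y : ℕ → X := fun m => if ‖x m‖ < l + ε then x m else 0
    have hy : ∀ m, ‖y m‖ ≤ l + ε := by
      intro m
      by_cases h : ‖x m‖ < l + ε
      · simp only [y, if_pos h]; exact h.le
      · simp only [y, if_neg h, norm_zero]; positivity
    let y' : lp (fun _ : ℕ => X) ∞ := ⟨y, memℓp_infty ⟨l + ε, by rintro _ ⟨m, rfl⟩; exact hy m⟩⟩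
    have hxy : (ultraNull 𝕜 X U).mkQL x = (ultraNull 𝕜 X U).mkQL y' := by
      refine (Submodule.Quotient.eq _).2 ?_
      change Tendsto (fun m => ‖x m - y m‖) U (𝓝 0)
      refine tendsto_const_nhds.congr' ?_
      filter_upwards [hev] with m hm
      simp [y, hm]
    rw [hxy]
    exact (Submodule.Quotient.norm_mk_le _ y').trans (lp.norm_le_of_forall_le (by positivity) hy)
  · obtain ⟨z, hz, hzr⟩ := Submodule.Quotient.norm_mk_lt ((ultraNull 𝕜 X U).mkQL x) hε
    have hzx : Tendsto (fun m => ‖x m - z m‖) U (𝓝 0) := (Submodule.Quotient.eq _).1 hz.symm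
    have h1 : Tendsto (fun m => ‖x m‖ - ‖x m - z m‖) U (𝓝 (l - 0)) := hl.sub hzx
    rw [sub_zero] at h1
    refine (le_of_tendsto' h1 fun m => ?_).trans hzr.le
    have h2 := norm_sub_le (x m) (x m - z m)
    have h3 := lp.norm_apply_le_norm (by simp) z m
    have h4 := norm_sub_norm_le (x m) (x m - z m)
    rw [sub_sub_cancel] at h4
    linarith

theorem abs_norm_sum_smul_sub_le {n : ℕ} {C : ℝ} {z : Fin n → X} (hz : ∀ i, ‖z i‖ ≤ C)
    (c c' : Fin n → 𝕜) :
    |‖∑ i, c i • z i‖ - ‖∑ i, c' i • z i‖| ≤ n * C * ‖c - c'‖ := by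
  refine (abs_norm_sub_norm_le _ _).trans ?_
  rw [← Finset.sum_sub_distrib]
  calc _ ≤ ∑ i, ‖c i • z i - c' i • z i‖ := norm_sum_le _ _
    _ ≤ ∑ _i : Fin n, ‖c - c'‖ * C := by
      refine Finset.sum_le_sum fun i _ => ?_
      rw [← sub_smul, norm_smul]
      gcongr
      · exact norm_le_pi_norm (c - c') i
      · exact hz i
    _ = n * C * ‖c - c'‖ := by simp; ring

theorem norm_sum_smul_apply_smul {n : ℕ} (a : 𝕜) (c : Fin n → 𝕜) (z : Fin n → X) :
    ‖∑ i, (a • c) i • z i‖ = ‖a‖ * ‖∑ i, c i • z i‖ := by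
  simp only [Pi.smul_apply, smul_assoc, ← Finset.smul_sum]
  exact norm_smul _ _

theorem lp_sum_smul_apply {ι : Type*} (s : Finset ι) (c : ι → 𝕜)
    (x : ι → lp (fun _ : ℕ => X) ∞) (m : ℕ) :
    (∑ i ∈ s, c i • x i : lp (fun _ : ℕ => X) ∞) m = ∑ i ∈ s, c i • x i m := by
  classical
  induction s using Finset.induction_on with
  | empty => simp
  | insert a s ha ih =>
    rw [Finset.sum_insert ha, Finset.sum_insert ha, lp.coeFn_add, Pi.add_apply, ih]
    rfl

/-- Norms of linear combinations of boundedly many bounded vectors that converge pointwise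
converge uniformly on bounded sets of coefficients. -/
theorem eventually_forall_abs_norm_sum_sub_le {α W : Type*} [NormedAddCommGroup W]
    [NormedSpace 𝕜 W] {l : Filter α} {n : ℕ} {C : ℝ} (hC : 0 ≤ C) {v : α → Fin n → X}
    {w : Fin n → W} (hv : ∀ m i, ‖v m i‖ ≤ C) (hw : ∀ i, ‖w i‖ ≤ C)
    (h : ∀ c : Fin n → 𝕜, Tendsto (fun m => ‖∑ i, c i • v m i‖) l (𝓝 ‖∑ i, c i • w i‖))
    {δ : ℝ} (hδ : 0 < δ) :
    ∀ᶠ m in l, ∀ c : Fin n → 𝕜, |‖∑ i, c i • v m i‖ - ‖∑ i, c i • w i‖| ≤ δ * ‖c‖ := by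
  -- Passing to a net point costs at most `δ / 4` for `v m` and again for `w`, and the net itself
  -- another `δ / 4`.
  let η := δ / (4 * (n * C + 1))
  have hη : 0 < η := by positivity
  have hηδ : n * C * η ≤ δ / 4 := by
    have : δ / 4 - n * C * η = η := by simp only [η]; field_simp; ring
    linarith
  obtain ⟨t, -, ht, hcov⟩ := Metric.finite_approx_of_totallyBounded
    (isCompact_sphere (0 : Fin n → 𝕜) 1).totallyBounded η hη
  have hev : ∀ᶠ m in l, ∀ c ∈ t, |‖∑ i, c i • v m i‖ - ‖∑ i, c i • w i‖| < δ / 4 := by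
    refine (eventually_all_finite ht).2 fun c _ => ?_
    have := Metric.tendsto_nhds.1 (h c) (δ / 4) (by positivity)
    simpa only [Real.dist_eq] using this
  filter_upwards [hev] with m hm c
  by_cases hc : c = 0
  · simp [hc]
  have hcpos : 0 < ‖c‖ := norm_pos_iff.2 hc
  have hsphere : ∀ u : Fin n → 𝕜, ‖u‖ = 1 → |‖∑ i, u i • v m i‖ - ‖∑ i, u i • w i‖| ≤ δ := by
    intro u hu
    obtain ⟨c', hc', huc⟩ := Set.mem_iUnion₂.1
      (hcov (by simpa using hu : u ∈ Metric.sphere (0 : Fin n → 𝕜) 1))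
    rw [Metric.mem_ball, dist_eq_norm] at huc
    have h1 := abs_norm_sum_smul_sub_le (hv m) u c'
    have h2 := abs_norm_sum_smul_sub_le hw u c'
    have h3 := hm c' hc'
    have h4 : n * C * ‖u - c'‖ ≤ δ / 4 := le_trans (by gcongr) hηδ
    rw [abs_le] at h1 h2 ⊢
    rw [abs_lt] at h3
    constructor <;> linarith [h1.1, h1.2, h2.1, h2.2, h3.1, h3.2]
  have hu := hsphere (((‖c‖⁻¹ : ℝ) : 𝕜) • c) (by
    rw [norm_smul, RCLike.norm_ofReal, abs_of_pos (by positivity)]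
    field_simp)
  rw [norm_sum_smul_apply_smul, norm_sum_smul_apply_smul, RCLike.norm_ofReal,
    abs_of_pos (by positivity : 0 < ‖c‖⁻¹), ← mul_sub, abs_mul, abs_of_pos (by positivity), inv_mul_le_iff₀ hcpos] at hu
  linarith

/-- A coefficient is the difference of two consecutive tail sums. This turns an error proportional
to `‖c‖` into one relative to the norm of the combination. -/
theorem IsWideS.norm_coeff_le {L : ℝ} {n : ℕ} {b : Fin n → X} (hL : 0 ≤ L) (hb : IsWideS 𝕜 L b)
    (c : Fin n → 𝕜) : ‖c‖ ≤ 2 * L * ‖∑ j, c j • b j‖ := by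
  refine (pi_norm_le_iff_of_nonneg (by positivity)).2 fun k => ?_
  have h1 := hb.tail_le k c
  have h2 : ‖∑ j ∈ Finset.Ioi k, c j‖ ≤ L * ‖∑ j, c j • b j‖ := by
    by_cases hk : (k : ℕ) + 1 < n
    · have : Finset.Ioi k = Finset.Ici (⟨k + 1, hk⟩ : Fin n) := by
        ext j
        simp only [Finset.mem_Ioi, Finset.mem_Ici, Fin.lt_def, Fin.le_def]
        omega
      rw [this]
      exact hb.tail_le _ c
    · have : Finset.Ioi k = ∅ := by
        ext j
        simp only [Finset.mem_Ioi, Fin.lt_def, Finset.notMem_empty, iff_false]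
        omega
      rw [this, Finset.sum_empty, norm_zero]
      positivity
  have h3 : c k = ∑ j ∈ Finset.Ici k, c j - ∑ j ∈ Finset.Ioi k, c j := by
    rw [← Finset.Ioi_insert, Finset.sum_insert (by simp), add_sub_cancel_right]
  rw [h3]
  have := norm_sub_le (∑ j ∈ Finset.Ici k, c j) (∑ j ∈ Finset.Ioi k, c j)
  linarith

/-- Being wide-(s) passes to almost isometric copies. -/
theorem IsWideS.of_almost_isometric {W : Type*} [NormedAddCommGroup W] [NormedSpace 𝕜 W]
    {L L' θ : ℝ} (hL : 0 ≤ L) (hθ0 : 0 ≤ θ) (hθ1 : θ < 1) (hθ : L * (1 + θ) ≤ L' * (1 - θ)) {n : ℕ}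
    {w : Fin n → W} {v : Fin n → X} (hw : IsWideS 𝕜 L w)
    (h : ∀ c : Fin n → 𝕜, |‖∑ i, c i • v i‖ - ‖∑ i, c i • w i‖| ≤ θ * ‖∑ i, c i • w i‖) :
    IsWideS 𝕜 L' v := by
  classical
  have hup : ∀ c : Fin n → 𝕜, ‖∑ i, c i • v i‖ ≤ (1 + θ) * ‖∑ i, c i • w i‖ := fun c => by
    have := (abs_le.1 (h c)).2; linarith
  have hlow : ∀ c : Fin n → 𝕜, (1 - θ) * ‖∑ i, c i • w i‖ ≤ ‖∑ i, c i • v i‖ := fun c => by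
    have := (abs_le.1 (h c)).1; linarith
  have hL'pos : 0 ≤ L' := by
    by_contra! hneg
    have h1 : L' * (1 - θ) < 0 := mul_neg_of_neg_of_pos hneg (by linarith)
    have h2 : 0 ≤ L * (1 + θ) := by positivity
    linarith
  have hLL' : L ≤ L' * (1 - θ) := by nlinarith
  have h1 : ∀ c : Fin n → 𝕜, L * (1 + θ) * ‖∑ i, c i • w i‖ ≤ L' * ‖∑ i, c i • v i‖ := fun c =>
    calc _ ≤ L' * (1 - θ) * ‖∑ i, c i • w i‖ := by gcongr
      _ = L' * ((1 - θ) * ‖∑ i, c i • w i‖) := by ring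
      _ ≤ _ := by gcongr; exact hlow c
  refine ⟨fun k c => ?_, fun j => ?_, fun k c => ?_⟩
  · let c' : Fin n → 𝕜 := fun j => if j ∈ Finset.Iic k then c j else 0
    have h2 := hup c'
    simp only [c', ite_smul, zero_smul, Finset.sum_ite_mem, Finset.univ_inter] at h2
    calc _ ≤ _ := h2
      _ ≤ (1 + θ) * (2 * L * ‖∑ i, c i • w i‖) := by gcongr; exact hw.basic k c
      _ = 2 * (L * (1 + θ) * ‖∑ i, c i • w i‖) := by ring
      _ ≤ 2 * (L' * ‖∑ i, c i • v i‖) := by gcongr 2 * ?_; exact h1 c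
      _ = _ := by ring
  · have h2 := hup (Pi.single j 1)
    simp only [Pi.single_apply, ite_smul, one_smul, zero_smul, Finset.sum_ite_eq',
      Finset.mem_univ, if_true] at h2
    have h3 := hw.norm_le j
    nlinarith
  · calc _ ≤ L * ‖∑ i, c i • w i‖ := hw.tail_le k c
      _ ≤ L * (1 + θ) * ‖∑ i, c i • w i‖ := by
        gcongr
        nlinarith
      _ ≤ _ := h1 c

/-- Representatives of a wide-(s) sequence in the ultrapower are eventually wide-(s), with a
slightly larger constant. -/
theorem IsWideS.eventually_of_ultrapower {U : Ultrafilter ℕ} {L L' : ℝ} (hL : 0 ≤ L)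
    (hLL' : L < L') {n : ℕ} {x : Fin n → lp (fun _ : ℕ => X) ∞}
    (hx : IsWideS 𝕜 L fun i => (ultraNull 𝕜 X U).mkQL (x i)) :
    ∀ᶠ m in (U : Filter ℕ), IsWideS 𝕜 L' fun i => x i m := by
  obtain ⟨θ, hθ0, hθ1, hθ⟩ : ∃ θ : ℝ, 0 < θ ∧ θ < 1 ∧ L * (1 + θ) ≤ L' * (1 - θ) := by
    refine ⟨(L' - L) / (L' + L + 1), by apply div_pos <;> linarith, ?_, ?_⟩
    · rw [div_lt_one (by linarith)]; linarith
    · have h0 : L' + L + 1 ≠ 0 := by linarith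
      have h1 : L' * (1 - (L' - L) / (L' + L + 1)) - L * (1 + (L' - L) / (L' + L + 1)) =
          (L' - L) / (L' + L + 1) := by field_simp; ring
      have h2 : 0 < (L' - L) / (L' + L + 1) := by apply div_pos <;> linarith
      linarith
  have hC : ∀ i, ‖x i‖ ≤ ∑ i, ‖x i‖ :=
    fun i => Finset.single_le_sum (f := fun i => ‖x i‖) (fun _ _ => norm_nonneg _)
      (Finset.mem_univ i)
  have hmk : ∀ c : Fin n → 𝕜, ∑ i, c i • (ultraNull 𝕜 X U).mkQL (x i) =
      (ultraNull 𝕜 X U).mkQL (∑ i, c i • x i) := fun c => by simp only [map_sum, map_smul]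
  -- The tolerance `θ / (2 * L + 1)` absorbs the factor `2 * L` from `IsWideS.norm_coeff_le`.
  have hev := eventually_forall_abs_norm_sum_sub_le (𝕜 := 𝕜) (l := (U : Filter ℕ))
    (C := ∑ i, ‖x i‖) (by positivity) (v := fun m i => x i m)
    (w := fun i => (ultraNull 𝕜 X U).mkQL (x i))
    (fun m i => (lp.norm_apply_le_norm (by simp) (x i) m).trans (hC i))
    (fun i => (Submodule.Quotient.norm_mk_le _ (x i)).trans (hC i))
    (fun c => by
      rw [hmk]
      simpa only [lp_sum_smul_apply] using tendsto_norm_ultrapower_mk (𝕜 := 𝕜) U (∑ i, c i • x i))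
    (δ := θ / (2 * L + 1)) (by positivity)
  filter_upwards [hev] with m hm
  refine hx.of_almost_isometric hL hθ0.le hθ1 hθ fun c => (hm c).trans ?_
  have h1 := hx.norm_coeff_le hL c
  calc _ ≤ θ / (2 * L + 1) * (2 * L * ‖∑ j, c j • (ultraNull 𝕜 X U).mkQL (x j)‖) := by gcongr
    _ = θ * ‖∑ j, c j • (ultraNull 𝕜 X U).mkQL (x j)‖ * (2 * L / (2 * L + 1)) := by ring
    _ ≤ θ * ‖∑ j, c j • (ultraNull 𝕜 X U).mkQL (x j)‖ * 1 := by
      gcongr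
      rw [div_le_one (by positivity)]
      linarith
    _ = _ := mul_one _

/-- A norm one element of the ultrapower has a representative with eventually normalized terms. -/
theorem exists_mk_eq_eventually_norm_eq_one {U : Ultrafilter ℕ} {z : Ultrapower 𝕜 X U}
    (hz : ‖z‖ = 1) : ∃ x : lp (fun _ : ℕ => X) ∞, (ultraNull 𝕜 X U).mkQL x = z ∧
      ∀ᶠ m in (U : Filter ℕ), ‖x m‖ = 1 := by
  obtain ⟨x, rfl⟩ := (ultraNull 𝕜 X U).mkQ_surjective z
  have hlim := tendsto_norm_ultrapower_mk (𝕜 := 𝕜) U x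
  change ‖(ultraNull 𝕜 X U).mkQL x‖ = 1 at hz
  rw [hz] at hlim
  have hne : ∀ᶠ m in (U : Filter ℕ), 0 < ‖x m‖ := hlim.eventually_const_lt one_pos
  -- Where `x m = 0`, the convention `0⁻¹ = 0` gives `y m = 0`, so `y` stays in the unit ball.
  let y : ℕ → X := fun m => ((‖x m‖⁻¹ : ℝ) : 𝕜) • x m
  have hynorm : ∀ m, ‖y m‖ = ‖x m‖⁻¹ * ‖x m‖ := fun m => by
    simp only [y]
    rw [norm_smul, RCLike.norm_ofReal, abs_of_nonneg (by positivity)]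
  have hy1 : ∀ m, ‖y m‖ ≤ 1 := fun m => by
    rw [hynorm]
    exact inv_mul_le_one
  refine ⟨⟨y, memℓp_infty ⟨1, by rintro _ ⟨m, rfl⟩; exact hy1 m⟩⟩,
    (Submodule.Quotient.eq _).2 ?_, ?_⟩
  · change Tendsto (fun m => ‖y m - x m‖) U (𝓝 0)
    have h0 : Tendsto (fun m => |1 - ‖x m‖|) U (𝓝 |1 - 1|) := (hlim.const_sub 1).abs
    rw [sub_self, abs_zero] at h0
    refine h0.congr' ?_
    filter_upwards [hne] with m hm
    have h1 : y m - x m = ((‖x m‖⁻¹ - 1 : ℝ) : 𝕜) • x m := by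
      simp only [y, RCLike.ofReal_sub, RCLike.ofReal_one, sub_smul, one_smul]
    rw [h1, norm_smul, RCLike.norm_ofReal]
    nth_rewrite 3 [← abs_of_pos hm]
    rw [← abs_mul, sub_mul, one_mul, inv_mul_cancel₀ hm.ne']
  · filter_upwards [hne] with m hm
    change ‖y m‖ = 1
    rw [hynorm, inv_mul_cancel₀ hm.ne']

theorem tendsto_norm_ultraOperator_mk (U : Ultrafilter ℕ) (T : X →L[𝕜] Y)
    (x : lp (fun _ : ℕ => X) ∞) :
    Tendsto (fun m => ‖T (x m)‖) U (𝓝 ‖ultraOperator U T ((ultraNull 𝕜 X U).mkQL x)‖) :=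
  tendsto_norm_ultrapower_mk (𝕜 := 𝕜) U (seqOperator T x)

theorem exists_isWideS_of_not_isSuperTauberian [CompleteSpace X] {U : Ultrafilter ℕ}
    {T : X →L[𝕜] Y} (hT : ¬ IsSuperTauberian U T) :
    ∃ L : ℝ, 1 ≤ L ∧ ∀ (n : ℕ) (ε : ℝ), 0 < ε → ∃ b : Fin n → X,
      IsWideS 𝕜 L b ∧ Metric.diam (Set.range fun i => T (b i)) < ε := by
  -- The constant is at most 2 in the ultrapower; any larger one, here 3, survives the descent to
  -- `X`.
  refine ⟨3, by norm_num, fun n ε hε => ?_⟩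
  obtain ⟨B, hB, hTB⟩ := exists_seq_isWideS_of_not_isTauberian hT
    (lt_min one_pos (half_pos hε) : 0 < min 1 (ε / 2))
  have hB2 : IsWideS 𝕜 2 fun i : Fin n => B i :=
    (hB n).mono (by linarith [min_le_left 1 (ε / 2)])
  choose x hx using fun i => (ultraNull 𝕜 X U).mkQ_surjective (B i)
  have hx : ∀ i, (ultraNull 𝕜 X U).mkQL (x i) = B i := hx
  simp only [← hx] at hB2 hTB
  have h1 := hB2.eventually_of_ultrapower (by norm_num) (by norm_num : (2 : ℝ) < 3)
  have h2 : ∀ᶠ m in (U : Filter ℕ), ∀ i j : Fin n, ‖T (x i m) - T (x j m)‖ < ε / 2 := by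
    refine eventually_all.2 fun i => eventually_all.2 fun j => ?_
    have h3 := tendsto_norm_ultraOperator_mk U T (x i - x j)
    rw [map_sub, map_sub] at h3
    have h4 := h3.eventually_lt_const ((hTB i j).trans_le (min_le_right _ _))
    filter_upwards [h4] with m hm
    rw [← map_sub]
    exact hm
  obtain ⟨m, hm1, hm2⟩ := (h1.and h2).exists
  exact ⟨_, hm1, diam_range_lt (half_pos hε).le (half_lt_self hε) fun i j => (hm2 i j).le⟩

theorem tailSum_eq_sum_Ico {k m : ℕ} {c : ℕ →₀ 𝕜} (hc : ∀ j, m ≤ j → c j = 0) :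
    tailSum 𝕜 k c = ∑ j ∈ Finset.Ico k m, c j := by
  rw [tailSum, Finsupp.linearCombination_apply, Finsupp.sum_of_support_subset c
    (s := Finset.range m) (fun j hj => by
      by_contra h
      exact Finsupp.mem_support_iff.1 hj (hc j (by simpa using h))) _ (by simp)]
  rw [← Finset.sum_subset (s₁ := Finset.Ico k m) (fun j hj => by
    simp only [Finset.mem_Ico, Finset.mem_range] at hj ⊢; omega) (fun j hj hj' => ?_)]
  · refine Finset.sum_congr rfl fun j hj => ?_
    rw [if_pos (Finset.mem_Ico.1 hj).1, smul_eq_mul, mul_one]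
  · rw [if_neg (by simp only [Finset.mem_Ico, Finset.mem_range] at hj hj'; omega), smul_zero]

/-- Finite wide-(s) sequences in `X` with small images under `T` give an infinite sequence in
the ultrapower, with uniformly bounded tail sums and constant image. -/
theorem exists_ultrapower_seq {U : Ultrafilter ℕ} (hU : (U : Filter ℕ) ≤ cofinite)
    {T : X →L[𝕜] Y}
    {L : ℝ} (hL : 1 ≤ L) (h : ∀ (n : ℕ) (ε : ℝ), 0 < ε → ∃ b : Fin n → X,
      IsWideS 𝕜 L b ∧ Metric.diam (Set.range fun i => T (b i)) < ε) :
    ∃ B : ℕ → Ultrapower 𝕜 X U, (∀ i, ‖B i‖ ≤ L) ∧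
      (∀ k c, ‖tailSum 𝕜 k c‖ ≤ L * ‖Finsupp.linearCombination 𝕜 B c‖) ∧
      ∀ i, ultraOperator U T (B i) = ultraOperator U T (B 0) := by
  have hlarge : ∀ N : ℕ, ∀ᶠ m in (U : Filter ℕ), N ≤ m := fun N =>
    (Nat.cofinite_eq_atTop ▸ hU) (eventually_ge_atTop N)
  -- Coordinate `m` uses a sequence of length `m`, padded with zeros, and tolerance `1 / (m + 1)`.
  -- As `m` tends to infinity along `U`, any fixed combination is eventually covered and the images
  -- coalesce.
  have h' : ∀ m : ℕ, ∃ b : ℕ → X, IsWideS 𝕜 L (fun i : Fin m => b i) ∧ (∀ j, ‖b j‖ ≤ L) ∧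
      ∀ i < m, ∀ j < m, ‖T (b i) - T (b j)‖ < 1 / (m + 1) := by
    intro m
    obtain ⟨b, hb, hd⟩ := h m (1 / (m + 1)) (by positivity)
    obtain ⟨b, rfl, hb0⟩ := exists_nat_extension b
    refine ⟨b, hb, fun j => ?_, fun i hi j hj =>
      norm_sub_lt_of_diam_range_lt hd ⟨i, hi⟩ ⟨j, hj⟩⟩
    by_cases hj : j < m
    · exact hb.norm_le ⟨j, hj⟩
    · rw [hb0 j (not_lt.1 hj), norm_zero]; linarith
  choose β hβ hβL hβT using h'
  let x : ℕ → lp (fun _ : ℕ => X) ∞ := fun i =>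
    ⟨fun m => β m i, memℓp_infty ⟨L, by rintro _ ⟨m, rfl⟩; exact hβL m i⟩⟩
  refine ⟨fun i => (ultraNull 𝕜 X U).mkQL (x i), fun i => ?_, fun k c => ?_, fun i => ?_⟩
  · exact le_of_tendsto' (tendsto_norm_ultrapower_mk (𝕜 := 𝕜) U (x i)) fun m => hβL m i
  · obtain ⟨N, hN⟩ : ∃ N, ∀ j, N ≤ j → c j = 0 := by
      refine ⟨c.support.sup id + 1, fun j hj => ?_⟩
      by_contra hne
      have : j ≤ c.support.sup id := Finset.le_sup (f := id) (Finsupp.mem_support_iff.2 hne)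
      omega
    have hmk : Finsupp.linearCombination 𝕜 (fun i => (ultraNull 𝕜 X U).mkQL (x i)) c =
        (ultraNull 𝕜 X U).mkQL (∑ j ∈ c.support, c j • x j) := by
      rw [Finsupp.linearCombination_apply, Finsupp.sum, map_sum]
      simp only [map_smul]
    rw [hmk]
    refine ge_of_tendsto ((tendsto_norm_ultrapower_mk (𝕜 := 𝕜) U _).const_mul L) ?_
    filter_upwards [hlarge (N + k + 1)] with m hm
    have hcoe : (∑ j ∈ c.support, c j • x j : lp (fun _ : ℕ => X) ∞) m =
        ∑ j ∈ Finset.range m, c j • β m j := by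
      rw [lp_sum_smul_apply]
      refine Finset.sum_subset (fun j hj => ?_) fun j _ hj => ?_
      · by_contra hjm
        exact Finsupp.mem_support_iff.1 hj (hN j (by
          have : m ≤ j := by simpa using hjm
          omega))
      · rw [Finsupp.notMem_support_iff.1 hj, zero_smul]
    rw [hcoe, tailSum_eq_sum_Ico (m := m) fun j hj => hN j (by omega)]
    exact (isWideS_iff_nat.1 (hβ m)).2.2 k (by omega) c
  · rw [← sub_eq_zero, ← norm_eq_zero, ← map_sub, ← map_sub]
    refine tendsto_nhds_unique (tendsto_norm_ultraOperator_mk U T (x i - x 0)) ?_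
    have h1 : Tendsto (fun m : ℕ => 1 / ((m : ℝ) + 1)) U (𝓝 0) :=
      tendsto_one_div_add_atTop_nhds_zero_nat.mono_left (Nat.cofinite_eq_atTop ▸ hU)
    refine squeeze_zero' (Eventually.of_forall fun m => norm_nonneg _) ?_ h1
    filter_upwards [hlarge (i + 1)] with m hm
    have h2 := hβT m i (by omega) 0 (by omega)
    rw [← map_sub] at h2
    exact h2.le

/-- As `T_U` is constant on the sequence `B`, the second adjoint sends the weak* limit of `B` to
that constant, a point of the target, although the limit is outside the ultrapower. -/
theorem not_isSuperTauberian_of_exists_isWideS {U : Ultrafilter ℕ}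
    (hU : (U : Filter ℕ) ≤ cofinite) {T : X →L[𝕜] Y}
    (h : ∃ L : ℝ, 1 ≤ L ∧ ∀ (n : ℕ) (ε : ℝ), 0 < ε → ∃ b : Fin n → X,
      IsWideS 𝕜 L b ∧ Metric.diam (Set.range fun i => T (b i)) < ε) :
    ¬ IsSuperTauberian U T := by
  obtain ⟨L, hL, h⟩ := h
  obtain ⟨B, hBL, hBt, hBT⟩ := exists_ultrapower_seq hU hL h
  obtain ⟨G, hG, hGlim⟩ := exists_tendsto_notMem_range_inclusion hBL hBt
  intro hT
  refine hT G hG ⟨ultraOperator U T (B 0), ?_⟩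
  ext g
  have h1 := hGlim (g.comp (ultraOperator U T))
  have h2 : (fun i => (g.comp (ultraOperator U T)) (B i)) = fun _ => g (ultraOperator U T (B 0)) :=
    funext fun i => congrArg g (hBT i)
  rw [h2] at h1
  exact tendsto_nhds_unique tendsto_const_nhds h1

/-- If the differences of a bounded sequence with uniformly bounded tail sums lie in a subspace,
then that subspace is not reflexive. -/
theorem exists_notMem_range_inclusion_submodule {B : ℕ → X} {L : ℝ} (hBL : ∀ i, ‖B i‖ ≤ L)
    (hB : ∀ k c, ‖tailSum 𝕜 k c‖ ≤ L * ‖Finsupp.linearCombination 𝕜 B c‖) (K : Submodule 𝕜 X)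
    (hK : ∀ j, B (j + 1) - B 0 ∈ K) :
    ∃ G : StrongDual 𝕜 (StrongDual 𝕜 K),
      G ∉ Set.range (NormedSpace.inclusionInDoubleDual 𝕜 K) := by
  let D : ℕ → K := fun j => ⟨B (j + 1) - B 0, hK j⟩
  -- Rewrites coefficients of the differences as coefficients of `B`. The correction sits at index
  -- 0, so tail sums from `k + 1` do not see it.
  let σ : (ℕ →₀ 𝕜) →ₗ[𝕜] ℕ →₀ 𝕜 :=
    Finsupp.linearCombination 𝕜 fun j => Finsupp.single (j + 1) 1 - Finsupp.single 0 1
  have hσD : ∀ c, ((Finsupp.linearCombination 𝕜 D c : K) : X) =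
      Finsupp.linearCombination 𝕜 B (σ c) := by
    intro c
    have : K.subtype ∘ₗ Finsupp.linearCombination 𝕜 D = Finsupp.linearCombination 𝕜 B ∘ₗ σ := by
      ext j
      simp [D, σ]
    exact LinearMap.congr_fun this c
  have hσt : ∀ k c, tailSum 𝕜 (k + 1) (σ c) = tailSum 𝕜 k c := by
    intro k c
    have : tailSum 𝕜 (k + 1) ∘ₗ σ = tailSum 𝕜 k := by
      ext j
      simp [tailSum, σ]
    exact LinearMap.congr_fun this c
  obtain ⟨G, hG, -⟩ := exists_tendsto_notMem_range_inclusion (𝕜 := 𝕜) (b := D) (C := 2 * L) (L := L)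
    (fun j => by
      have := norm_sub_le (B (j + 1)) (B 0)
      change ‖B (j + 1) - B 0‖ ≤ 2 * L
      linarith [hBL (j + 1), hBL 0])
    (fun k c => by
      rw [← hσt, Submodule.coe_norm, hσD]
      exact hB _ _)
  exact ⟨G, hG⟩

theorem IsWideS.coe {K : Submodule 𝕜 X} {L : ℝ} {n : ℕ} {b : Fin n → K} (hb : IsWideS 𝕜 L b) :
    IsWideS 𝕜 L fun i => (b i : X) where
  basic k c := by simpa using hb.basic k c
  norm_le := hb.norm_le
  tail_le k c := by simpa using hb.tail_le k c

/-- The differences `B (j + 1) - B 0` lie in the kernel of `T_U`, which is therefore not reflexive.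
Its unit sphere supplies almost optimal sequences, and their coordinates in `X` have images tending
to 0 along `U`. -/
theorem exists_normalized_isWideS_of_exists_isWideS [CompleteSpace X] {U : Ultrafilter ℕ}
    (hU : (U : Filter ℕ) ≤ cofinite) {T : X →L[𝕜] Y}
    (h : ∃ L : ℝ, 1 ≤ L ∧ ∀ (n : ℕ) (ε : ℝ), 0 < ε → ∃ b : Fin n → X,
      IsWideS 𝕜 L b ∧ Metric.diam (Set.range fun i => T (b i)) < ε) {ε : ℝ} (hε : 0 < ε) (n : ℕ) :
    ∃ b : Fin n → X, IsWideS 𝕜 (1 + ε) b ∧ (∀ i, ‖b i‖ = 1) ∧ ∀ i, ‖T (b i)‖ < ε := by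
  obtain ⟨L, hL, h⟩ := h
  obtain ⟨B, hBL, hBt, hBT⟩ := exists_ultrapower_seq hU hL h
  let K : Submodule 𝕜 (Ultrapower 𝕜 X U) := (ultraOperator U T).ker
  have : CompleteSpace K := (ultraOperator U T).isClosed_ker.completeSpace_coe
  obtain ⟨G, hG⟩ := exists_notMem_range_inclusion_submodule hBL hBt K fun j =>
    LinearMap.mem_ker.2 ((map_sub _ _ _).trans (sub_eq_zero.2 (hBT (j + 1))))
  obtain ⟨b, hb, hb1⟩ := exists_seq_isWideS_norm_eq_one hG (half_pos hε)
  choose x hx hx1 using fun i =>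
    exists_mk_eq_eventually_norm_eq_one (z := (b i : Ultrapower 𝕜 X U)) (hb1 i)
  have hb' : IsWideS 𝕜 (1 + ε / 2) fun i : Fin n => (ultraNull 𝕜 X U).mkQL (x i) := by
    have hxb : (fun i : Fin n => (ultraNull 𝕜 X U).mkQL (x i)) = fun i : Fin n => (b i).1 :=
      funext fun i => hx i
    rw [hxb]
    exact (hb n).coe
  have h1 := hb'.eventually_of_ultrapower (by positivity) (by linarith : 1 + ε / 2 < 1 + ε)
  have h2 : ∀ᶠ m in (U : Filter ℕ), ∀ i : Fin n, ‖x i m‖ = 1 := eventually_all.2 fun i => hx1 i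
  have h3 : ∀ᶠ m in (U : Filter ℕ), ∀ i : Fin n, ‖T (x i m)‖ < ε := by
    refine eventually_all.2 fun i => ?_
    have h4 := tendsto_norm_ultraOperator_mk U T (x i)
    have h5 : ultraOperator U T ((ultraNull 𝕜 X U).mkQL (x i)) = 0 := by
      rw [hx]
      exact (b i).2
    rw [h5, norm_zero] at h4
    exact h4.eventually_lt_const hε
  obtain ⟨m, hm1, hm2, hm3⟩ := (h1.and (h2.and h3)).exists
  exact ⟨_, hm1, hm2, hm3⟩

end UltrapowerTransfer

/-! ### The equivalence, through 1 ⇔ 2 ⇔ 4 and the cycle 2 → 5 → 3 → 2. -/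

theorem proposition20 {𝕜 : Type*} [RCLike 𝕜]
    {X Y : Type*} [NormedAddCommGroup X] [NormedSpace 𝕜 X] [CompleteSpace X]
    [NormedAddCommGroup Y] [NormedSpace 𝕜 Y] [CompleteSpace Y]
    (U : Ultrafilter ℕ) (hU : (U : Filter ℕ) ≤ Filter.cofinite) (T : X →L[𝕜] Y) :
    List.TFAE [
      ¬ IsSuperTauberian U T,
      ∃ L : ℝ, 1 ≤ L ∧ ∀ (n : ℕ) (ε : ℝ), 0 < ε → ∃ b : Fin n → X,
        IsWideS 𝕜 L b ∧ Metric.diam (Set.range fun i => T (b i)) < ε,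
      ∀ (ε : ℝ), 0 < ε → ∀ n : ℕ, ∃ b : Fin n → X,
        IsWideS 𝕜 (1 + ε) b ∧ Metric.diam (Set.range fun i => T (b i)) < ε,
      ∃ L : ℝ, 1 ≤ L ∧ ∀ (n : ℕ) (ε : ℝ), 0 < ε → ∃ e : Fin n → X,
        IsWideC 𝕜 L e ∧ ∑ i, ‖T (e i)‖ < ε,
      ∀ (ε : ℝ), 0 < ε → ∀ n : ℕ, ∃ b : Fin n → X,
        IsWideS 𝕜 (1 + ε) b ∧ (∀ i, ‖b i‖ = 1) ∧ ∀ i, ‖T (b i)‖ < ε] := by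
  tfae_have 1 → 2 := exists_isWideS_of_not_isSuperTauberian
  tfae_have 2 → 1 := not_isSuperTauberian_of_exists_isWideS hU
  tfae_have 2 → 4 := exists_isWideC_of_exists_isWideS
  tfae_have 4 → 2 := exists_isWideS_of_exists_isWideC
  tfae_have 2 → 5 := fun h ε hε n => exists_normalized_isWideS_of_exists_isWideS hU h hε n
  tfae_have 5 → 3 := by
    intro h ε hε n
    obtain ⟨b, hb, -, hTb⟩ := h (ε / 3) (by positivity) n
    refine ⟨b, hb.mono (by linarith), diam_range_lt (δ := 2 * (ε / 3)) (by positivity)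
      (by linarith) fun i j => (norm_sub_le _ _).trans ?_⟩
    linarith [hTb i, hTb j]
  tfae_have 3 → 2 := by
    intro h
    refine ⟨2, by norm_num, fun n ε hε => ?_⟩
    obtain ⟨b, hb, hd⟩ := h (min 1 ε) (by positivity) n
    exact ⟨b, hb.mono (by linarith [min_le_left 1 ε]), hd.trans_le (min_le_right _ _)⟩
  tfae_finish
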